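/- **Setting.** Let $d\ge 1$ and $\beta\in(0,\infty)$. For $k\in\mathbb N=\{1,2,\dots\}$ and $x,y\in\mathbb R^d$ let $\mu^{(k)}_{x,y}$ be the canonical Brownian bridge measure on continuous paths $f\colon[0,k\beta]\to\mathbb R^d$ for Brownian motion with generator $\Delta$, that is, $\mu^{(k)}_{x,y}(A)=\mathbb P_x(B\in A;B_{k\beta}\in\mathrm dy)/\mathrm dy$, of total mass $(4\pi k\beta)^{-d/2}\mathrm e^{-|x-y|^2/(4k\beta)}$. Such an $f$ has *length* $\ell(f)=k$, *particles* $f(0),f(\beta),\dots,f((k-1)\beta)$ and *legs* $f_i=f((i-1)\beta+\cdot)|_{[0,\beta]}$, $i=1,\dots,k$. For a centred box $\Lambda=[-a,a]^d$ and $\mathrm{bc}\in\{\mathrm{per},0,\mathrm{par}\}$ let $\mu^{(k,\Lambda,0)}_{x,y}$ and $\mu^{(k,\Lambda,\mathrm{par})}_{x,y}$ be the restrictions of $\mu^{(k)}_{x,y}$ to paths that stay in $\Lambda$, respectively to paths with $f(l\beta)\in\Lambda$ for $l=0,1,\dots,k$, and let $\mu^{(k,\Lambda,\mathrm{per})}_{x,y}$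 be the bridge measure of Brownian motion on the torus $\mathbb R^d/2a\mathbb Z^d$, that is, $\sum_{n\in\mathbb Z^d}\mu^{(k)}_{x,y+2an}$ on lifted paths. Put $$\nu^{(\mathrm{bc})}_\Lambda(\mathrm dx,\mathrm df)=\sum_{k\in\mathbb N}\frac1k\,\mathrm dx\otimes\mu^{(k,\Lambda,\mathrm{bc})}_{x,x}(\mathrm df),\qquad x\in\Lambda .$$ *Assumption (V).* The potential $v\colon\mathbb R^d\to[0,\infty)$ is bounded and continuous with compact support, and there is $C>0$ such that for every box $W=\prod_i[\alpha_i,\gamma_i]\supset[-1,1]^d$, every $k\in\mathbb N$ and all $x_1,\dots,x_k\in W$, $$\sum_{1\le i<j\le k}v(x_i-x_j)\ge C\Big(\frac{k^2}{|W|}-k\Big).$$ For a finite configuration $\omega=\sum_{x\in\zeta}\delta_{(x,f_x)}$ let $$\Phi_{\Lambda,\Lambda}(\omega)=\frac12\sum_{x,y\in\zeta}\ \sum_{i=1}^{\ell(f_x)}\sum_{j=1}^{\ell(f_y)}\mathbf 1\{(x,i)\ne(y,j)\}\int_0^\beta v\big(f_{x,i}(s)-f_{y,j}(s)\big)\,\mathrm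 ds ,$$ where for $\mathrm{bc}=\mathrm{per}$ the potential $v$ is replaced by its periodisation $\sum_{n\in\mathbb Z^d}v(\cdot+2an)$. Let $\widehat{\mathtt Q}^{(\Lambda,\mathrm{bc})}$ be the law with density proportional to $\mathrm e^{-\Phi_{\Lambda,\Lambda}}$ with respect to the Poisson point process with intensity measure $\nu=\nu^{(\mathrm{bc})}_\Lambda$; that is, under $\widehat{\mathtt Q}^{(\Lambda,\mathrm{bc})}$, $$\widehat{\mathtt Q}^{(\Lambda,\mathrm{bc})}(A)=\frac{\sum_{n\ge0}\frac1{n!}\int \mathbf 1_A\,\mathrm e^{-\Phi_{\Lambda,\Lambda}}\,\mathrm d\nu^{\otimes n}}{\sum_{n\ge0}\frac1{n!}\int \mathrm e^{-\Phi_{\Lambda,\Lambda}}\,\mathrm d\nu^{\otimes n}},$$ where the integrands are evaluated at $\omega=\sum_{p=1}^n\delta_{(x_p,f_p)}$. (This formula is the definition for $\mathrm{bc}=\mathrm{per}$, where $\nu$ has infinite total mass.) For $r>0$ call a loop *non-crossing* if all its particles (for $\mathrm{bc}=\mathrm{per}$: their representatives in $\Lambda$) lie in one of the subboxes $z+[-r,r]^d$,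 $z\in2r\mathbb Z^d$, and *crossing* otherwise. For $L\in\mathbb N_0$ let $$\mathfrak N^{(\ell,r)}_{\Lambda,\le L}(\omega)=\sum_{x\in\zeta}\ell(f_x)\mathbf 1\{f_x\text{ crossing},\ \ell(f_x)\le L\},\qquad \mathfrak N^{(\ell,\neg r)}_{\Lambda,>L}(\omega)=\sum_{x\in\zeta}\ell(f_x)\mathbf 1\{f_x\text{ non-crossing},\ \ell(f_x)>L\}.$$ **Lemma 3.2 (Equivalence of condensate notions).** Suppose that $v$ satisfies Assumption (V). Fix $\rho\in(0,\infty)$ and centred boxes $\Lambda_N=[-a_N,a_N]^d$, $a_N>0$, with $|\Lambda_N|/N\to1/\rho$ as $N\to\infty$. Then there are sequences $(L_R^{\le})_{R\in\mathbb N}$ and $(L_R^{>})_{R\in\mathbb N}$ of nonnegative integers, both tending to $\infty$ as $R\to\infty$, such that the following holds for all $r_{R,N}$ ($R,N\in\mathbb N$) with $\lim_{N\to\infty}r_{R,N}=R$ for each $R$ and such that, for each $R$ and all sufficiently large $N$, the box $\Lambda_N$ is a union of subboxes $z+[-r_{R,N},r_{R,N}]^d$ with $z\in2r_{R,N}\mathbb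 Z^d$: for every $\mathrm{bc}\in\{\mathrm{per},0,\mathrm{par}\}$ and every $\varepsilon\in(0,1)$, $$\limsup_{R\to\infty}\limsup_{N\to\infty}\frac1{|\Lambda_N|}\log\widehat{\mathtt Q}^{(\Lambda_N,\mathrm{bc})}\Big(\mathfrak N^{(\ell,r_{R,N})}_{\Lambda_N,\le L_R^{\le}}>\varepsilon|\Lambda_N|\Big)=-\infty,$$ $$\limsup_{R\to\infty}\limsup_{N\to\infty}\frac1{|\Lambda_N|}\log\widehat{\mathtt Q}^{(\Lambda_N,\mathrm{bc})}\Big(\mathfrak N^{(\ell,\neg r_{R,N})}_{\Lambda_N,>L_R^{>}}>\varepsilon|\Lambda_N|\Big)=-\infty.$$ -/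

import Mathlib

open scoped NNReal ENNReal

namespace BoseLoops

noncomputable section

/-- The Euclidean space `ℝ^d`. -/
abbrev Space (d : ℕ) : Type := EuclideanSpace ℝ (Fin d)

/-! ### Boxes and the interaction potential -/

/-- The cube `c + [-r, r]^d`. -/
def cube {d : ℕ} (c : Space d) (r : ℝ) : Set (Space d) :=
  {y | ∀ i, |y i - c i| ≤ r}

/-- The volume `(2 a)^d` of the centred box `Λ = [-a, a]^d`. -/
def boxVolume (d : ℕ) (a : ℝ) : ℝ := (2 * a) ^ d

/-- The lattice point `s • n`, for `n ∈ ℤ^d`. -/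
def latticePoint {d : ℕ} (s : ℝ) (n : Fin d → ℤ) : Space d :=
  WithLp.toLp 2 fun i => s * (n i : ℝ)

/-- The box `[-a, a]^d` is the union of subboxes `z + [-r, r]^d` with `z` in a subset of
`2 r ℤ^d`. -/
def IsPartitioned (d : ℕ) (a r : ℝ) : Prop :=
  ∃ Z : Set (Fin d → ℤ),
    cube (0 : Space d) a = ⋃ n ∈ Z, cube (latticePoint (2 * r) n) r

/-- The assumption on the pair potential: nonnegative, bounded, continuous, of compact support,
and superstable on all boxes `∏ [lo i, hi i]` that contain `[-1, 1]^d`. -/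
structure AssumptionV {d : ℕ} (v : Space d → ℝ) : Prop where
  nonneg : ∀ x, 0 ≤ v x
  bounded : ∃ M, ∀ x, v x ≤ M
  continuous : Continuous v
  compactSupport : HasCompactSupport v
  superstable : ∃ C > 0, ∀ lo hi : Fin d → ℝ, (∀ i, lo i ≤ -1 ∧ 1 ≤ hi i) →
    ∀ (k : ℕ) (x : Fin k → Space d), (∀ p i, lo i ≤ x p i ∧ x p i ≤ hi i) →
      C * ((k : ℝ) ^ 2 / (∏ i, (hi i - lo i)) - k)
        ≤ ∑ p, ∑ q ∈ Finset.univ.filter (fun q => p < q), v (x p - x q)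

/-! ### Path spaces and Wiener measure -/

/-- The σ-algebra on continuous paths generated by the evaluations (for paths on an interval it is
the Borel σ-algebra of locally uniform convergence). -/
instance pathMeasurableSpace (T : Type*) [TopologicalSpace T] (d : ℕ) :
    MeasurableSpace C(T, Space d) :=
  MeasurableSpace.comap (fun f t => f t) MeasurableSpace.pi

/-- `W` is Wiener measure on `C([0, ∞), ℝ^d)`: under `W`, the coordinate process is a standard
`d`-dimensional Brownian motion started at `0`, that is, its `d` components are independent
standard Brownian motions. This determines `W` uniquely. -/
structure IsWienerMeasure {d : ℕ} (W : MeasureTheory.Measure C(ℝ≥0, Space d)) : Prop where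
  brownian : ∀ i : Fin d, ProbabilityTheory.IsBrownianReal (fun t w => w t i) W
  indep : ProbabilityTheory.iIndepFun (fun (i : Fin d) (w : C(ℝ≥0, Space d)) (t : ℝ≥0) => w t i) W

/-- `C_k`: continuous paths `[0, k β] → ℝ^d`. -/
abbrev PathSpace (d : ℕ) (β : ℝ≥0) (k : ℕ) : Type :=
  C(Set.Iic ((k : ℝ≥0) * β), Space d)

/-- The disjoint union of the spaces `C_k`; the first component `k` is the length `ℓ(f)`. -/
abbrev Path (d : ℕ) (β : ℝ≥0) : Type := Σ k : ℕ, PathSpace d β k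

/-- The value `f(t)` (only used for `0 ≤ t ≤ ℓ(f) β`). -/
def Path.eval {d : ℕ} {β : ℝ≥0} (f : Path d β) (t : ℝ) : Space d :=
  f.2 ⟨min t.toNNReal ((f.1 : ℝ≥0) * β), Set.mem_Iic.2 (min_le_right _ _)⟩

/-- The path `t ↦ x + (t/T) (y - x) + √2 (w(t) - (t/T) w(T))` on `[0, T]`. If `w` is a standard
Brownian motion, this is a Brownian bridge from `x` to `y` in time `T` for the Brownian motion
with generator `Δ` (that is, with variance `2 t` per coordinate). -/
def bridgePath {d : ℕ} (T : ℝ≥0) (x y : Space d) (w : C(ℝ≥0, Space d)) :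
    C(Set.Iic T, Space d) where
  toFun t := x + ((t : ℝ≥0) / T : ℝ) • (y - x)
    + √2 • (w (t : ℝ≥0) - ((t : ℝ≥0) / T : ℝ) • w T)
  continuous_toFun := by fun_prop

/-- The Gaussian kernel `g_T(x, y) = (4 π T)^{-d/2} exp(-|x - y|² / (4 T))` of `e^{T Δ}`. -/
def heatKernel {d : ℕ} (T : ℝ) (x y : Space d) : ℝ :=
  (4 * Real.pi * T) ^ (-(d : ℝ) / 2) * Real.exp (-‖x - y‖ ^ 2 / (4 * T))

/-- The canonical (unnormalised) free Brownian bridge measure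
`μ^{(k)}_{x,y}(A) = P_x(B ∈ A; B_{kβ} ∈ dy) / dy`, of total mass `g_{kβ}(x, y)`. -/
def bridgeMeasure {d : ℕ} (W : MeasureTheory.Measure C(ℝ≥0, Space d)) (β : ℝ≥0) (k : ℕ)
    (x y : Space d) : MeasureTheory.Measure (PathSpace d β k) :=
  ENNReal.ofReal (heatKernel ((k : ℝ) * β) x y) • W.map (bridgePath ((k : ℝ≥0) * β) x y)

/-! ### Boundary conditions -/

/-- The boundary conditions: periodic, Dirichlet zero, and particle boundary condition. -/
inductive BC where
  | per
  | zero
  | par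

/-- The bridge measure `μ^{(k,Λ,bc)}_{x,y}` in the box `Λ = [-a, a]^d`.
* Periodic: Brownian motion on the torus `ℝ^d / 2aℤ^d`. A continuous path on the torus with
  starting point in `Λ` is represented by its lift to `ℝ^d` with the same starting point; the lift
  of a torus path from `x` to `y` ends in `y + 2 a n` for some `n ∈ ℤ^d`.
* Dirichlet zero: Brownian motion killed on leaving `Λ`.
* Particle: all particles `f(0), f(β), …, f(kβ)` are in `Λ`. -/
def bcBridgeMeasure {d : ℕ} (W : MeasureTheory.Measure C(ℝ≥0, Space d)) (β : ℝ≥0) (bc : BC)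
    (a : ℝ) (k : ℕ) (x y : Space d) : MeasureTheory.Measure (PathSpace d β k) :=
  match bc with
  | .per => MeasureTheory.Measure.sum fun n : Fin d → ℤ =>
      bridgeMeasure W β k x (y + latticePoint (2 * a) n)
  | .zero => (bridgeMeasure W β k x y).restrict {f | ∀ t, f t ∈ cube 0 a}
  | .par => (bridgeMeasure W β k x y).restrict
      {f | ∀ l ≤ k, Path.eval ⟨k, f⟩ ((l : ℝ) * β) ∈ cube 0 a}

/-- The position in the box `Λ = [-a, a]^d` of a point: in the periodic case its representative
modulo `2 a ℤ^d` in `[-a, a)^d`, otherwise the point itself. -/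
def position {d : ℕ} (bc : BC) (a : ℝ) (y : Space d) : Space d :=
  match bc with
  | .per => WithLp.toLp 2 fun i => y i - 2 * a * (⌊(y i + a) / (2 * a)⌋ : ℝ)
  | .zero => y
  | .par => y

/-- The pair potential as seen in the box: in the periodic case the potential on the torus, that
is, the periodisation of `v` (a finite sum as `v` has compact support), otherwise `v` itself. -/
def bcPotential {d : ℕ} (bc : BC) (a : ℝ) (v : Space d → ℝ) (y : Space d) : ℝ :=
  match bc with
  | .per => ∑' n : Fin d → ℤ, v (y + latticePoint (2 * a) n)
  | .zero => v y
  | .par => v y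

/-! ### The loop soup and its Gibbs transform -/

/-- Points of `ℝ^d` with a path as a mark. -/
abbrev MarkedPoint (d : ℕ) (β : ℝ≥0) : Type := Space d × Path d β

/-- The intensity measure `ν(dx, df) = ∑_{k ≥ 1} (1/k) dx ⊗ μ^{(k,Λ,bc)}_{x,x}(df)`, with `x` in
`Λ = [-a, a]^d`. -/
def intensity {d : ℕ} (W : MeasureTheory.Measure C(ℝ≥0, Space d)) (β : ℝ≥0) (bc : BC) (a : ℝ) :
    MeasureTheory.Measure (MarkedPoint d β) :=
  MeasureTheory.Measure.sum fun k : ℕ+ => ((k : ℕ) : ℝ≥0∞)⁻¹ •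
    (MeasureTheory.volume.restrict (cube (0 : Space d) a)).bind fun x =>
      (bcBridgeMeasure W β bc a k x x).map
        (fun f => ((x, ⟨(k : ℕ), f⟩) : MarkedPoint d β))

/-- Finite configurations `ω = ∑_p δ_{z p}`, with the points listed as `z : Fin n → X`. All
functionals of configurations below are invariant under relabelling. -/
abbrev Config (X : Type*) : Type _ := Σ n : ℕ, Fin n → X

/-- The measure `∑_n (1/n!) ν^{⊗ n}` on finite configurations, which is `e^{ν(X)}` times the
law of the Poisson point process with intensity measure `ν`, if `ν` is finite. -/
def poissonWeight {X : Type*} [MeasurableSpace X] (ν : MeasureTheory.Measure X) :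
    MeasureTheory.Measure (Config X) :=
  MeasureTheory.Measure.sum fun n : ℕ => ((n.factorial : ℕ) : ℝ≥0∞)⁻¹ •
    (MeasureTheory.Measure.pi fun _ : Fin n => ν).map (Sigma.mk n)

/-- The law of the Poisson point process with finite intensity measure `ν`: the number of points is
Poisson distributed with parameter `ν(X)`, and given their number the points are independent with
law `ν / ν(X)`. -/
def poissonLaw {X : Type*} [MeasurableSpace X] (ν : MeasureTheory.Measure X) :
    MeasureTheory.Measure (Config X) :=
  ENNReal.ofReal (Real.exp (-(ν Set.univ).toReal)) • poissonWeight ν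

/-- `V(f_i, g_j) = ∫_0^β v(f_i(s) - g_j(s)) ds`, the interaction between the leg `f_i` of `f` that
starts at time `i β` and the leg `g_j` of `g` that starts at time `j β`. -/
def legInteraction {d : ℕ} {β : ℝ≥0} (v : Space d → ℝ) (f g : Path d β) (i j : ℕ) : ℝ :=
  ∫ s in (0 : ℝ)..β, v (f.eval (i * β + s) - g.eval (j * β + s))

/-- The interaction `Φ_{Λ,Λ}(ω)`: one half of the sum of the interactions over all ordered pairs of
different legs `(p, i) ≠ (q, j)` of the configuration. -/
def interaction {d : ℕ} {β : ℝ≥0} (v : Space d → ℝ) (ω : Config (MarkedPoint d β)) : ℝ :=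
  ∑ p, ∑ q, (1 / 2 : ℝ) *
    ∑ i ∈ Finset.range (ω.2 p).2.1, ∑ j ∈ Finset.range (ω.2 q).2.1,
      if (p, i) ≠ (q, j) then legInteraction v (ω.2 p).2 (ω.2 q).2 i j else 0

/-- The Boltzmann factor `e^{-Φ}`. -/
def boltzmann {d : ℕ} {β : ℝ≥0} (v : Space d → ℝ) (ω : Config (MarkedPoint d β)) : ℝ≥0∞ :=
  ENNReal.ofReal (Real.exp (-interaction v ω))

/-- The normalised measure `H dM / ∫ H dM`. -/
def tilted {Y : Type*} [MeasurableSpace Y] (M : MeasureTheory.Measure Y) (H : Y → ℝ≥0∞) :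
    MeasureTheory.Measure Y :=
  (∫⁻ y, H y ∂M)⁻¹ • M.withDensity H

/-- The total mass of `∑_n (1/n!) ν^{⊗ n}` is `e^{ν(X)}`, so that `poissonLaw ν` is a probability
measure. -/
theorem poissonLaw_univ {X : Type*} [MeasurableSpace X] (ν : MeasureTheory.Measure X)
    [MeasureTheory.IsFiniteMeasure ν] : poissonLaw ν Set.univ = 1 := by
  have hm : ν Set.univ ≠ ∞ := MeasureTheory.measure_ne_top ν _
  set m : ℝ := (ν Set.univ).toReal with hm_def
  have hm0 : 0 ≤ m := ENNReal.toReal_nonneg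
  have hν : ν Set.univ = ENNReal.ofReal m := (ENNReal.ofReal_toReal hm).symm
  have hsum : HasSum (fun n : ℕ => m ^ n / (n.factorial : ℝ)) (Real.exp m) := by
    rw [Real.exp_eq_exp_ℝ]
    exact NormedSpace.expSeries_div_hasSum_exp m
  have key : poissonWeight ν Set.univ = ENNReal.ofReal (Real.exp m) := by
    unfold poissonWeight
    rw [MeasureTheory.Measure.sum_apply _ MeasurableSet.univ, ← hsum.tsum_eq,
      ENNReal.ofReal_tsum_of_nonneg (fun n => by positivity) hsum.summable]
    refine tsum_congr fun n => ?_
    rw [MeasureTheory.Measure.smul_apply, smul_eq_mul, MeasureTheory.Measure.map_apply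
      (measurable_iff_le_map.2 (iInf_le _ n)) MeasurableSet.univ, Set.preimage_univ, MeasureTheory.Measure.pi_univ]
    simp only [Finset.prod_const, Finset.card_univ, Fintype.card_fin]
    rw [hν, ← ENNReal.ofReal_pow hm0, ENNReal.ofReal_div_of_pos (by positivity),
      ENNReal.ofReal_natCast, ENNReal.div_eq_inv_mul]
  rw [poissonLaw, MeasureTheory.Measure.smul_apply, smul_eq_mul, key,
    ← ENNReal.ofReal_mul (Real.exp_pos _).le, ← Real.exp_add, ← hm_def]
  simp

/-- For a finite intensity measure, tilting the Poisson law and tilting `∑_n (1/n!) ν^{⊗ n}` is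
the same, since the constant `e^{-ν(X)}` cancels. -/
theorem tilted_poissonLaw {X : Type*} [MeasurableSpace X] (ν : MeasureTheory.Measure X)
    (H : Config X → ℝ≥0∞) : tilted (poissonLaw ν) H = tilted (poissonWeight ν) H := by
  set c : ℝ≥0∞ := ENNReal.ofReal (Real.exp (-(ν Set.univ).toReal)) with hc
  have hc0 : c ≠ 0 := by simp [hc, Real.exp_pos]
  have hct : c ≠ ∞ := ENNReal.ofReal_ne_top
  unfold tilted poissonLaw
  rw [← hc, MeasureTheory.lintegral_smul_measure, MeasureTheory.withDensity_smul_measure,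
    smul_smul, smul_eq_mul, ENNReal.mul_inv (Or.inl hc0) (Or.inl hct), mul_comm c⁻¹, mul_assoc,
    ENNReal.inv_mul_cancel hc0 hct, mul_one]

/-- The transformed measure `dQ̂ = e^{-Φ} dQ / Q[e^{-Φ}]`, where `Q` is the Poisson point process
with intensity measure `ν = intensity W β bc a`. For zero and particle boundary conditions, `ν` is
finite, and this is literally `tilted (poissonLaw ν) e^{-Φ}`, see `tilted_poissonLaw`. For periodic
boundary conditions, `ν` has infinite total mass because of the very long loops, but
`∑_n (1/n!) ∫ e^{-Φ} dν^{⊗ n}` is finite for superstable `v`; the definition is then the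
limit as `K → ∞` of the measures for the intensity measure restricted to loops of length at most
`K`. -/
def transformedLaw {d : ℕ} (W : MeasureTheory.Measure C(ℝ≥0, Space d)) (β : ℝ≥0)
    (v : Space d → ℝ) (bc : BC) (a : ℝ) : MeasureTheory.Measure (Config (MarkedPoint d β)) :=
  tilted (poissonWeight (intensity W β bc a)) (boltzmann (bcPotential bc a v))

/-! ### Particle numbers -/

/-- All the particles `f(0), f(β), …, f((ℓ(f) - 1) β)` of `f` lie in one of the subboxes
`z + [-r, r]^d`, `z ∈ 2 r ℤ^d`. -/
def NonCrossing {d : ℕ} {β : ℝ≥0} (bc : BC) (a r : ℝ) (f : Path d β) : Prop :=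
  ∃ n : Fin d → ℤ, ∀ l < f.1,
    position bc a (f.eval (l * β)) ∈ cube (latticePoint (2 * r) n) r

open Classical in
/-- The number of particles in crossing loops of length `≤ L`. (All points of the configuration are
in `Λ`.) -/
def particlesCrossingLe {d : ℕ} {β : ℝ≥0} (bc : BC) (a r : ℝ) (L : ℕ)
    (ω : Config (MarkedPoint d β)) : ℕ :=
  ∑ p, if ¬ NonCrossing bc a r (ω.2 p).2 ∧ (ω.2 p).2.1 ≤ L then (ω.2 p).2.1 else 0

open Classical in
/-- The number of particles in noncrossing loops of length `> L`. -/
def particlesNonCrossingGt {d : ℕ} {β : ℝ≥0} (bc : BC) (a r : ℝ) (L : ℕ)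
    (ω : Config (MarkedPoint d β)) : ℕ :=
  ∑ p, if NonCrossing bc a r (ω.2 p).2 ∧ L < (ω.2 p).2.1 then (ω.2 p).2.1 else 0

end

end BoseLoops

/-!
Everything is a Chernoff bound for the Gibbs transform of the Poisson configurations. Let `m(f)` be
the length of the loop `f` if `f` is to be counted, and `0` otherwise. The partition function is at
least `1`, and the interaction dominates the sum of the self-energies `Φ₁(f)` of the loops, so
`Q̂(∑ m(f) > c) ≤ exp (-θ c + ∫ h dν)` whenever `h ≥ exp (θ m - Φ₁)`. It remains to find such an `h`
with `∫ h dν ≤ C₁ |Λ| + C₂`, where only `C₂` depends on `θ`.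

* The loops of length `k` have total mass of order `|Λ| (k^{-1/2} + |Λ|⁻¹) / k`, and the sum over
  the lengths up to a multiple of `|Λ|` is at most `C₁ |Λ| + C₂`. Longer loops, which on the torus
  have infinite mass, are suppressed by superstability.
* A long noncrossing loop has its particles in a subbox. Either most of its legs stay close to their
  particles, and superstability in a slightly larger box gives a self-energy above `θ k`, or the
  total displacement of the legs is large, which has small probability by an exponential moment.
* A crossing loop of length at most `L` starts at distance less than `D` from a face of a subbox, or
  its displacement is at least `D`. With `D = √R` both have small mass compared to `exp (-L²)` if
  `L = L_R` tends to infinity slowly enough.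
-/

namespace BoseLoops

open MeasureTheory ProbabilityTheory

/-! ### Chernoff bounds for tilted Poisson configurations -/

section Poisson

theorem lintegral_fin_nat_prod_eq_prod {n : ℕ} {E : Fin n → Type*} [∀ i, MeasurableSpace (E i)]
    {μ : ∀ i, Measure (E i)} [∀ i, SigmaFinite (μ i)] {f : ∀ i, E i → ℝ≥0∞}
    (hf : ∀ i, Measurable (f i)) :
    ∫⁻ x, ∏ i, f i (x i) ∂Measure.pi μ = ∏ i, ∫⁻ x, f i x ∂μ i := by
  induction n with
  | zero => simp
  | succ n ih =>
    rw [← ((measurePreserving_piFinSuccAbove μ 0).symm).lintegral_comp_emb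
      (MeasurableEquiv.measurableEmbedding _)]
    simp only [MeasurableEquiv.piFinSuccAbove_symm_apply, Fin.insertNthEquiv_zero,
      Fin.prod_univ_succ]
    rw [← ih fun i => hf i.succ, ← lintegral_prod_mul (hf 0).aemeasurable
      (Finset.measurable_prod _ fun i _ =>
        (hf i.succ).comp (measurable_pi_apply i)).aemeasurable]
    rfl

theorem measurable_sigmaMk {ι : Type*} {Y : ι → Type*} [∀ i, MeasurableSpace (Y i)] (i : ι) :
    Measurable (Sigma.mk i : Y i → Sigma Y) :=
  measurable_iff_le_map.2 (iInf_le _ i)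

theorem measurable_of_comp_sigmaMk {ι Z : Type*} {Y : ι → Type*} [∀ i, MeasurableSpace (Y i)]
    [MeasurableSpace Z] {f : Sigma Y → Z} (hf : ∀ i, Measurable fun y => f ⟨i, y⟩) :
    Measurable f := fun s hs => by
  rw [MeasurableSpace.measurableSet_iInf]
  exact fun i => hf i hs

variable {X : Type*} [MeasurableSpace X]

theorem measurable_prod_points {h : X → ℝ≥0∞} (hh : Measurable h) :
    Measurable fun ω : Config X => ∏ p, h (ω.2 p) :=
  measurable_of_comp_sigmaMk fun n =>
    show Measurable fun z : Fin n → X => ∏ p, h (z p) from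
      Finset.measurable_prod _ fun i _ => hh.comp (measurable_pi_apply i)

theorem lintegral_prod_poissonWeight (ν : Measure X) [SigmaFinite ν] {h : X → ℝ≥0∞}
    (hh : Measurable h) :
    ∫⁻ ω, ∏ p, h (ω.2 p) ∂poissonWeight ν
      = ∑' n : ℕ, ((n.factorial : ℕ) : ℝ≥0∞)⁻¹ * (∫⁻ x, h x ∂ν) ^ n := by
  unfold poissonWeight
  rw [lintegral_sum_measure]
  refine tsum_congr fun n => ?_
  rw [lintegral_smul_measure, lintegral_map (measurable_prod_points hh) (measurable_sigmaMk n),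
    smul_eq_mul]
  have hprod := lintegral_fin_nat_prod_eq_prod (μ := fun _ : Fin n => ν) fun _ => hh
  rw [Finset.prod_const, Finset.card_univ, Fintype.card_fin] at hprod
  exact congrArg _ hprod

theorem lintegral_prod_poissonWeight_le (ν : Measure X) [SigmaFinite ν] {h : X → ℝ≥0∞}
    (hh : Measurable h) {b : ℝ} (hb : 0 ≤ b) (hν : ∫⁻ x, h x ∂ν ≤ ENNReal.ofReal b) :
    ∫⁻ ω, ∏ p, h (ω.2 p) ∂poissonWeight ν ≤ ENNReal.ofReal (Real.exp b) := by
  have hsum : HasSum (fun n : ℕ => b ^ n / (n.factorial : ℝ)) (Real.exp b) := by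
    rw [Real.exp_eq_exp_ℝ]
    exact NormedSpace.expSeries_div_hasSum_exp b
  rw [lintegral_prod_poissonWeight ν hh, ← hsum.tsum_eq,
    ENNReal.ofReal_tsum_of_nonneg (fun n => by positivity) hsum.summable]
  refine ENNReal.tsum_le_tsum fun n => ?_
  rw [ENNReal.ofReal_div_of_pos (by positivity), ENNReal.ofReal_natCast, ENNReal.div_eq_inv_mul,
    ENNReal.ofReal_pow hb]
  gcongr

instance poissonWeight.instSFinite (ν : Measure X) [SigmaFinite ν] :
    SFinite (poissonWeight ν) := by
  unfold poissonWeight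
  infer_instance

theorem measurableSet_setOf_fst_eq_zero : MeasurableSet {ω : Config X | ω.1 = 0} :=
  measurable_of_comp_sigmaMk (f := fun ω : Config X => ω.1) (fun _ => measurable_const)
    (measurableSet_singleton 0)

theorem poissonWeight_setOf_fst_eq_zero (ν : Measure X) : poissonWeight ν {ω | ω.1 = 0} = 1 := by
  have hterm (n : ℕ) : ((n.factorial : ℕ) : ℝ≥0∞)⁻¹ •
      (Measure.pi fun _ : Fin n => ν).map (Sigma.mk n) {ω : Config X | ω.1 = 0}
        = if n = 0 then 1 else 0 := by
    rw [Measure.map_apply (measurable_sigmaMk n) measurableSet_setOf_fst_eq_zero]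
    rcases eq_or_ne n 0 with rfl | hn <;> simp [*]
  unfold poissonWeight
  rw [Measure.sum_apply _ measurableSet_setOf_fst_eq_zero]
  simpa only [Measure.smul_apply, hterm] using tsum_ite_eq 0 fun _ => (1 : ℝ≥0∞)

theorem one_le_lintegral_poissonWeight (ν : Measure X) {H : Config X → ℝ≥0∞}
    (hH : ∀ z : Fin 0 → X, 1 ≤ H ⟨0, z⟩) : 1 ≤ ∫⁻ ω, H ω ∂poissonWeight ν := by
  rw [← poissonWeight_setOf_fst_eq_zero ν,
    ← lintegral_indicator_one measurableSet_setOf_fst_eq_zero]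
  refine lintegral_mono fun ω => Set.indicator_le ?_ ω
  rintro ⟨_, z⟩ rfl
  exact hH z

theorem tilted_le_setLIntegral {M : Measure X} [SFinite M] {H : X → ℝ≥0∞}
    (hM : 1 ≤ ∫⁻ y, H y ∂M) (A : Set X) : tilted M H A ≤ ∫⁻ y in A, H y ∂M := by
  rw [tilted, Measure.smul_apply, smul_eq_mul, withDensity_apply']
  exact mul_le_of_le_one_left' (ENNReal.inv_le_one.2 hM)

theorem tilted_poissonWeight_le (ν : Measure X) [SigmaFinite ν] {H : Config X → ℝ≥0∞}
    (hH0 : ∀ z : Fin 0 → X, 1 ≤ H ⟨0, z⟩) (m : X → ℕ) (e : X → ℝ)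
    (hH : ∀ ω : Config X, H ω ≤ ENNReal.ofReal (Real.exp (-∑ p, e (ω.2 p))))
    {θ : ℝ} (hθ : 0 ≤ θ) {h : X → ℝ≥0∞} (hh : Measurable h)
    (hle : ∀ x, ENNReal.ofReal (Real.exp (θ * m x - e x)) ≤ h x)
    {b : ℝ} (hb : 0 ≤ b) (hν : ∫⁻ x, h x ∂ν ≤ ENNReal.ofReal b) (c : ℝ) :
    tilted (poissonWeight ν) H {ω | c < ((∑ p, m (ω.2 p) : ℕ) : ℝ)}
      ≤ ENNReal.ofReal (Real.exp (-(θ * c) + b)) := by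
  have hmarkov : ∀ ω ∈ {ω : Config X | c < ((∑ p, m (ω.2 p) : ℕ) : ℝ)},
      H ω ≤ ENNReal.ofReal (Real.exp (-(θ * c))) * ∏ p, h (ω.2 p) := fun ω hω => by
    have hθc : θ * c ≤ ∑ p, θ * (m (ω.2 p) : ℝ) := by
      rw [← Finset.mul_sum]
      exact mul_le_mul_of_nonneg_left (by exact_mod_cast (le_of_lt hω)) hθ
    calc H ω ≤ ENNReal.ofReal (Real.exp (-∑ p, e (ω.2 p))) := hH ω
      _ ≤ ENNReal.ofReal (Real.exp (-(θ * c) + ∑ p, (θ * m (ω.2 p) - e (ω.2 p)))) := by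
          gcongr
          rw [Finset.sum_sub_distrib]
          linarith
      _ = ENNReal.ofReal (Real.exp (-(θ * c)))
            * ∏ p, ENNReal.ofReal (Real.exp (θ * m (ω.2 p) - e (ω.2 p))) := by
          rw [Real.exp_add, Real.exp_sum, ENNReal.ofReal_mul (Real.exp_pos _).le,
            ENNReal.ofReal_prod_of_nonneg fun _ _ => (Real.exp_pos _).le]
      _ ≤ _ := by gcongr; exact hle _
  calc tilted (poissonWeight ν) H {ω | c < ((∑ p, m (ω.2 p) : ℕ) : ℝ)}
      ≤ ∫⁻ ω in {ω : Config X | c < ((∑ p, m (ω.2 p) : ℕ) : ℝ)}, H ω ∂poissonWeight ν :=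
        tilted_le_setLIntegral (one_le_lintegral_poissonWeight ν hH0) _
    _ ≤ ∫⁻ ω, ENNReal.ofReal (Real.exp (-(θ * c))) * ∏ p, h (ω.2 p) ∂poissonWeight ν :=
        (setLIntegral_mono ((measurable_prod_points hh).const_mul _) hmarkov).trans
          (setLIntegral_le_lintegral _ _)
    _ ≤ ENNReal.ofReal (Real.exp (-(θ * c) + b)) := by
        rw [lintegral_const_mul _ (measurable_prod_points hh), Real.exp_add,
          ENNReal.ofReal_mul (Real.exp_pos _).le]
        gcongr
        exact lintegral_prod_poissonWeight_le ν hh hb hν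

end Poisson

/-! ### Gaussian sums and exponential moments -/

section Moments

theorem tsum_fin_pi_prod {ι : Type*} {d : ℕ} (f : Fin d → ι → ℝ≥0∞) :
    ∑' n : Fin d → ι, ∏ c, f c (n c) = ∏ c, ∑' m, f c m := by
  induction d with
  | zero => simp
  | succ d ih =>
    rw [← (Fin.consEquiv fun _ : Fin (d + 1) => ι).tsum_eq, ENNReal.tsum_prod']
    simp only [Fin.consEquiv_apply, Fin.prod_univ_succ, Fin.cons_zero, Fin.cons_succ,
      ENNReal.tsum_mul_left, ih fun c => f c.succ, ENNReal.tsum_mul_right]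

theorem sum_range_exp_neg_mul_sq_le {q : ℝ} (hq : 0 < q) (n : ℕ) :
    ∑ i ∈ Finset.range n, Real.exp (-q * ((i : ℝ) + 1) ^ 2) ≤ √(Real.pi / q) / 2 := by
  have hanti : AntitoneOn (fun x : ℝ => Real.exp (-q * x ^ 2)) (Set.Icc (0 : ℝ) (0 + n)) :=
    fun x hx y _ hxy => Real.exp_le_exp.2 <| by
      nlinarith [mul_le_mul_of_nonneg_left (pow_le_pow_left₀ hx.1 hxy 2) hq.le]
  have hsum := hanti.sum_le_integral
  simp only [zero_add, Nat.cast_add, Nat.cast_one] at hsum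
  refine hsum.trans ?_
  rw [← integral_gaussian_Ioi q, intervalIntegral.integral_of_le (by positivity)]
  exact setIntegral_mono_set (integrable_exp_neg_mul_sq hq).integrableOn
    (.of_forall fun x => (Real.exp_pos _).le) (.of_forall fun x hx => hx.1)

theorem tsum_int_exp_neg_mul_sq_le {q : ℝ} (hq : 0 < q) :
    ∑' m : ℤ, ENNReal.ofReal (Real.exp (-q * (m : ℝ) ^ 2))
      ≤ ENNReal.ofReal (1 + √(Real.pi / q)) := by
  have hhalf : ∑' n : ℕ, ENNReal.ofReal (Real.exp (-q * ((n : ℝ) + 1) ^ 2))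
      ≤ ENNReal.ofReal (√(Real.pi / q) / 2) := by
    rw [ENNReal.tsum_eq_iSup_nat]
    refine iSup_le fun n => ?_
    rw [← ENNReal.ofReal_sum_of_nonneg fun _ _ => (Real.exp_pos _).le]
    exact ENNReal.ofReal_le_ofReal (sum_range_exp_neg_mul_sq_le hq n)
  rw [tsum_of_add_one_of_neg_add_one ENNReal.summable ENNReal.summable]
  push_cast
  simp only [even_two.neg_pow]
  calc _ ≤ ENNReal.ofReal (√(Real.pi / q) / 2) + ENNReal.ofReal (Real.exp (-q * 0 ^ 2))
        + ENNReal.ofReal (√(Real.pi / q) / 2) := by gcongr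
    _ = _ := by
        rw [← ENNReal.ofReal_add (by positivity) (by positivity),
          ← ENNReal.ofReal_add (by positivity) (by positivity)]
        congr 1
        rw [zero_pow two_ne_zero, mul_zero, Real.exp_zero]
        ring

variable {Ω : Type*} [MeasurableSpace Ω] {P : Measure Ω}

theorem lintegral_exp_sum_le {ι : Type*} [Fintype ι] [Nonempty ι] {U : ι → Ω → ℝ}
    (hU : ∀ i, Measurable (U i)) {b : ℝ≥0∞}
    (hb : ∀ i, ∫⁻ ω, ENNReal.ofReal (Real.exp (Fintype.card ι * U i ω)) ∂P ≤ b) :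
    ∫⁻ ω, ENNReal.ofReal (Real.exp (∑ i, U i ω)) ∂P ≤ b := by
  have hcard : (Fintype.card ι : ℝ) ≠ 0 := by positivity
  have hweights : ∑ _i : ι, (Fintype.card ι : ℝ)⁻¹ = 1 := by simp [hcard]
  calc ∫⁻ ω, ENNReal.ofReal (Real.exp (∑ i, U i ω)) ∂P
      = ∫⁻ ω, ∏ i, ENNReal.ofReal (Real.exp (Fintype.card ι * U i ω))
          ^ (Fintype.card ι : ℝ)⁻¹ ∂P := by
        refine lintegral_congr fun ω => ?_
        rw [Real.exp_sum, ENNReal.ofReal_prod_of_nonneg fun _ _ => (Real.exp_pos _).le]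
        refine Finset.prod_congr rfl fun i _ => ?_
        rw [ENNReal.ofReal_rpow_of_pos (Real.exp_pos _), ← Real.exp_mul, mul_right_comm,
          mul_inv_cancel₀ hcard, one_mul]
    _ ≤ ∏ i, (∫⁻ ω, ENNReal.ofReal (Real.exp (Fintype.card ι * U i ω)) ∂P)
          ^ (Fintype.card ι : ℝ)⁻¹ :=
        ENNReal.lintegral_prod_norm_pow_le _ (fun i _ =>
          (Real.measurable_exp.comp ((hU i).const_mul _)).ennreal_ofReal.aemeasurable)
          hweights fun _ _ => by positivity
    _ ≤ ∏ _i : ι, b ^ (Fintype.card ι : ℝ)⁻¹ := by gcongr; exact hb _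
    _ = b := by
        rw [Finset.prod_const, Finset.card_univ, ← ENNReal.rpow_natCast, ← ENNReal.rpow_mul,
          inv_mul_cancel₀ hcard, ENNReal.rpow_one]

theorem lintegral_exp_mul_of_hasLaw_gaussianReal {Y : Ω → ℝ} {m : ℝ} {σ : ℝ≥0}
    (hY : HasLaw Y (gaussianReal m σ) P) (t : ℝ) :
    ∫⁻ ω, ENNReal.ofReal (Real.exp (t * Y ω)) ∂P
      = ENNReal.ofReal (Real.exp (m * t + σ * t ^ 2 / 2)) := by
  have := hY.isProbabilityMeasure
  have hmgf := mgf_gaussianReal hY.map_eq t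
  have hint : Integrable (fun ω => Real.exp (t * Y ω)) P := by
    rw [← mgf_pos_iff, hmgf]
    exact Real.exp_pos _
  rw [← ofReal_integral_eq_lintegral_ofReal hint (.of_forall fun _ => (Real.exp_pos _).le),
    ← hmgf, mgf]

theorem lintegral_exp_mul_abs_le {Y : Ω → ℝ} {σ : ℝ≥0} (hY : HasLaw Y (gaussianReal 0 σ) P)
    (κ : ℝ) :
    ∫⁻ ω, ENNReal.ofReal (Real.exp (κ * |Y ω|)) ∂P
      ≤ ENNReal.ofReal (2 * Real.exp (κ ^ 2 * σ / 2)) := by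
  have hmeas : AEMeasurable (fun ω => ENNReal.ofReal (Real.exp (κ * Y ω))) P :=
    (Real.measurable_exp.comp_aemeasurable (hY.aemeasurable.const_mul κ)).ennreal_ofReal
  calc _ ≤ ∫⁻ ω, (ENNReal.ofReal (Real.exp (κ * Y ω))
        + ENNReal.ofReal (Real.exp (-κ * Y ω))) ∂P := by
        gcongr with ω
        rcases abs_cases (Y ω) with ⟨h, _⟩ | ⟨h, _⟩
        · rw [h]; exact le_self_add
        · rw [h, mul_neg, ← neg_mul]; exact le_add_self
    _ = _ := by
        rw [lintegral_add_left' hmeas, lintegral_exp_mul_of_hasLaw_gaussianReal hY,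
          lintegral_exp_mul_of_hasLaw_gaussianReal hY,
          ← ENNReal.ofReal_add (Real.exp_pos _).le (Real.exp_pos _).le]
        congr 1
        simp only [zero_mul, zero_add, neg_sq, mul_comm (σ : ℝ)]
        ring

theorem iIndepFun_increments {B : ℝ≥0 → Ω → ℝ} (hB : HasIndepIncrements B P) {s β : ℝ≥0}
    (hs : s ≤ β) : iIndepFun (fun (i : ℕ) ω => B (i * β + s) ω - B (i * β) ω) P := by
  let t (j : ℕ) : ℝ≥0 := ((j / 2 : ℕ) : ℝ≥0) * β + if Even j then 0 else s
  have heven (i : ℕ) : t (2 * i) = i * β := by simp [t]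
  have hodd (i : ℕ) : t (2 * i + 1) = i * β + s := by
    simp [t, show (2 * i + 1) / 2 = i by omega]
  have ht : Monotone t := by
    refine monotone_nat_of_le_succ fun j => ?_
    obtain ⟨i, rfl | rfl⟩ := Nat.even_or_odd' j
    · rw [heven, hodd]
      exact le_self_add
    · rw [hodd, show 2 * i + 1 + 1 = 2 * (i + 1) by ring, heven]
      push_cast
      rw [add_mul, one_mul]
      gcongr
  simpa only [heven, hodd] using
    (hB.nat ht).precomp (g := fun i : ℕ => 2 * i) fun a b h => by simpa using h

theorem lintegral_exp_sum_abs_increments_le {B : ℝ≥0 → Ω → ℝ} (hB : IsPreBrownianReal B P)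
    (hm : ∀ t, Measurable (B t)) {s β : ℝ≥0} (hs : s ≤ β) (κ : ℝ) (k : ℕ) :
    ∫⁻ ω, ENNReal.ofReal (Real.exp (κ * ∑ i ∈ Finset.range k, |B (i * β + s) ω - B (i * β) ω|)) ∂P
      ≤ ENNReal.ofReal ((2 * Real.exp (κ ^ 2 * β / 2)) ^ k) := by
  have hindep := (iIndepFun_increments hB.hasIndepIncrements hs).comp
    (fun _ x => ENNReal.ofReal (Real.exp (κ * |x|))) fun _ => by fun_prop
  have hlaw (i : ℕ) : ∫⁻ ω, ENNReal.ofReal (Real.exp (κ * |B (i * β + s) ω - B (i * β) ω|)) ∂P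
      ≤ ENNReal.ofReal (2 * Real.exp (κ ^ 2 * β / 2)) := by
    have hdist : nndist ((i * β + s : ℝ≥0) : ℝ) ((i * β : ℝ≥0) : ℝ) = s := by ext; simp
    refine (lintegral_exp_mul_abs_le (hB.hasLaw_sub (i * β + s) (i * β)) κ).trans ?_
    gcongr
    exact hdist.trans_le hs
  calc _ = ∫⁻ ω, ∏ i ∈ Finset.range k,
        ENNReal.ofReal (Real.exp (κ * |B (i * β + s) ω - B (i * β) ω|)) ∂P := by
        refine lintegral_congr fun ω => ?_
        rw [Finset.mul_sum, Real.exp_sum, ENNReal.ofReal_prod_of_nonneg fun _ _ =>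
          (Real.exp_pos _).le]
    _ = ∏ i ∈ Finset.range k, ∫⁻ ω,
        ENNReal.ofReal (Real.exp (κ * |B (i * β + s) ω - B (i * β) ω|)) ∂P :=
        lintegral_prod_eq_prod_lintegral_of_indepFun (Finset.range k) _ hindep fun i =>
          (Real.measurable_exp.comp (((hm (i * β + s)).sub (hm (i * β))).abs.const_mul
            κ)).ennreal_ofReal
    _ ≤ ENNReal.ofReal ((2 * Real.exp (κ ^ 2 * β / 2)) ^ k) := by
        refine (Finset.prod_le_prod' fun i _ => hlaw i).trans_eq ?_
        rw [Finset.prod_const, Finset.card_range, ENNReal.ofReal_pow (by positivity)]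

end Moments

/-! ### Displacements in a Brownian bridge -/

section Bridge

variable {d : ℕ} {β : ℝ≥0}

/-- The sum over all legs `f_i` of the `ℓ¹` distance between `f_i(s)` and the particle `f_i(0)`.
It measures how far a path strays from its particles. -/
noncomputable def displacement (s : ℝ) (f : Path d β) : ℝ :=
  ∑ i ∈ Finset.range f.1, ∑ c, |f.eval (i * β + s) c - f.eval (i * β) c|

theorem continuous_eval (f : Path d β) : Continuous fun t : ℝ => f.eval t := by
  unfold Path.eval
  fun_prop

theorem continuous_displacement (f : Path d β) : Continuous fun s => displacement s f := by
  have heval := continuous_eval f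
  unfold displacement
  fun_prop

theorem measurable_apply_path {T : Type*} [TopologicalSpace T] (t : T) :
    Measurable fun f : C(T, Space d) => f t :=
  (measurable_pi_apply t).comp (comap_measurable _)

theorem measurable_apply_path_coord {T : Type*} [TopologicalSpace T] (t : T) (c : Fin d) :
    Measurable fun f : C(T, Space d) => f t c :=
  (show Measurable fun y : Space d => y c by fun_prop).comp (measurable_apply_path t)

theorem measurable_eval (k : ℕ) (t : ℝ) :
    Measurable fun f : PathSpace d β k => Path.eval ⟨k, f⟩ t :=
  measurable_apply_path (T := Set.Iic ((k : ℝ≥0) * β))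
    ⟨min t.toNNReal ((k : ℝ≥0) * β), Set.mem_Iic.2 (min_le_right _ _)⟩

theorem measurable_displacement (s : ℝ) :
    Measurable fun f : Path d β => displacement s f := by
  refine measurable_of_comp_sigmaMk fun k => ?_
  have heval := measurable_eval (d := d) (β := β) k
  change Measurable fun f : PathSpace d β k => ∑ i ∈ Finset.range k, ∑ c,
    |Path.eval ⟨k, f⟩ (i * β + s) c - Path.eval ⟨k, f⟩ (i * β) c|
  fun_prop

theorem measurable_displacement_uncurry :
    Measurable fun p : ℝ × Path d β => displacement p.1 p.2 :=
  measurable_uncurry_of_continuous_of_measurable continuous_displacement measurable_displacement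

theorem bridgePath_apply (T : ℝ≥0) (x y : Space d) (w : C(ℝ≥0, Space d)) (t : Set.Iic T)
    (c : Fin d) : bridgePath T x y w t c
      = x c + ((t : ℝ≥0) / T : ℝ) * (y c - x c) + √2 * (w t c - ((t : ℝ≥0) / T : ℝ) * w T c) := by
  simp [bridgePath]

theorem measurable_bridgePath (T : ℝ≥0) (x y : Space d) : Measurable (bridgePath T x y) := by
  refine measurable_comap_iff.2 (measurable_pi_iff.2 fun t =>
    (WithLp.measurable_toLp 2 _).comp (measurable_pi_iff.2 fun c => ?_))
  have happly := fun t : ℝ≥0 => measurable_apply_path_coord (d := d) t c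
  have hbridge : (fun w => bridgePath T x y w t c) = _ :=
    funext fun w => bridgePath_apply T x y w t c
  refine hbridge ▸ Measurable.const_add (Measurable.const_mul ?_ _) _
  exact (happly _).sub ((happly T).const_mul _)

theorem abs_bridgePath_sub_le {T : ℝ≥0} (x y : Space d) (w : C(ℝ≥0, Space d)) {t u : Set.Iic T}
    (hut : u ≤ t) (c : Fin d) :
    |bridgePath T x y w t c - bridgePath T x y w u c|
      ≤ √2 * |w t c - w u c|
        + ((t : ℝ≥0) - (u : ℝ≥0) : ℝ) / T * (|y c - x c| + √2 * |w T c|) := by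
  have hut' : ((u : ℝ≥0) : ℝ) ≤ (t : ℝ≥0) := hut
  have hfrac : 0 ≤ ((t : ℝ≥0) - (u : ℝ≥0) : ℝ) / T := div_nonneg (sub_nonneg.2 hut') T.2
  calc _ = |√2 * (w t c - w u c)
        + ((t : ℝ≥0) - (u : ℝ≥0) : ℝ) / T * ((y c - x c) - √2 * w T c)| := by
        rw [bridgePath_apply, bridgePath_apply]
        congr 1
        ring
    _ ≤ _ := by
        refine (abs_add_le _ _).trans ?_
        rw [abs_mul, abs_mul, abs_of_nonneg (Real.sqrt_nonneg 2), abs_of_nonneg hfrac]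
        gcongr
        refine (abs_sub _ _).trans_eq ?_
        rw [abs_mul, abs_of_nonneg (Real.sqrt_nonneg 2)]

theorem eval_of_le {k : ℕ} (f : PathSpace d β k) {t : ℝ≥0} (ht : t ≤ k * β) :
    Path.eval ⟨k, f⟩ (t : ℝ) = f ⟨t, ht⟩ := by
  simp only [Path.eval, Real.toNNReal_coe, min_eq_left ht]

theorem displacement_bridgePath_le {k : ℕ} (hk : 1 ≤ k) (hβ : 0 < β) {s : ℝ≥0} (hs : s ≤ β)
    (x y : Space d) (w : C(ℝ≥0, Space d)) :
    displacement (s : ℝ) (⟨k, bridgePath (k * β) x y w⟩ : Path d β)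
      ≤ ∑ c, |y c - x c| + ∑ c, (√2 * ∑ i ∈ Finset.range k, |w (i * β + s) c - w (i * β) c|
          + √2 * |w (k * β) c|) := by
  have : (0 : ℝ) < β := hβ
  have hk' : (0 : ℝ) < k := by positivity
  have hfrac : (s : ℝ) / (k * β) ≤ 1 / k := by
    rw [div_le_div_iff₀ (by positivity) hk', one_mul, mul_comm]
    gcongr
  have hleg (c : Fin d) : ∀ i ∈ Finset.range k,
      |Path.eval (⟨k, bridgePath (k * β) x y w⟩ : Path d β) (i * β + s) c
        - Path.eval (⟨k, bridgePath (k * β) x y w⟩ : Path d β) (i * β) c|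
      ≤ √2 * |w (i * β + s) c - w (i * β) c| + 1 / k * (|y c - x c| + √2 * |w (k * β) c|) := by
    intro i hi
    have hend : (i : ℝ≥0) * β + s ≤ k * β := by
      calc (i : ℝ≥0) * β + s ≤ ((i + 1 : ℕ) : ℝ≥0) * β := by
            push_cast
            rw [add_mul, one_mul]
            gcongr
        _ ≤ k * β := by gcongr; exact Finset.mem_range.1 hi
    have hstart : (i : ℝ≥0) * β ≤ k * β := le_self_add.trans hend
    have e1 := eval_of_le (bridgePath (k * β) x y w) hstart
    have e2 := eval_of_le (bridgePath (k * β) x y w) hend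
    push_cast at e1 e2
    rw [e1, e2]
    refine (abs_bridgePath_sub_le x y w (t := ⟨_, hend⟩) (u := ⟨_, hstart⟩)
      (Subtype.mk_le_mk.2 le_self_add) c).trans ?_
    push_cast
    rw [add_sub_cancel_left]
    gcongr
  have hcancel : (k : ℝ) * (1 / k) = 1 := by field_simp
  unfold displacement
  rw [Finset.sum_comm, ← Finset.sum_add_distrib]
  refine Finset.sum_le_sum fun c _ => (Finset.sum_le_sum (hleg c)).trans_eq ?_
  rw [Finset.sum_add_distrib, Finset.sum_const, Finset.card_range, nsmul_eq_mul, ← Finset.mul_sum]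
  linear_combination (|y c - x c| + √2 * |w (k * β) c|) * hcancel

/-- The Gaussian kernel `(4 π T)^{-d/2} exp(-|x - y|² / (8 T))`. It bounds exponential moments of
displacements, at the cost of half of the exponent of the heat kernel. -/
noncomputable def widenedHeatKernel (T : ℝ) (x y : Space d) : ℝ :=
  (4 * Real.pi * T) ^ (-(d : ℝ) / 2) * Real.exp (-‖x - y‖ ^ 2 / (8 * T))

theorem sum_abs_sub_le {T : ℝ} (hT : 0 < T) (x y : Space d) :
    ∑ c, |y c - x c| ≤ ‖x - y‖ ^ 2 / (8 * T) + 2 * d * T := by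
  have hcoord (c : Fin d) : |y c - x c| ≤ (x c - y c) ^ 2 / (8 * T) + 2 * T := by
    rw [← sq_abs, abs_sub_comm (x c)]
    have hsq : 0 ≤ (|y c - x c| - 4 * T) ^ 2 / (8 * T) := by positivity
    have hexpand : (|y c - x c| - 4 * T) ^ 2 / (8 * T)
        = |y c - x c| ^ 2 / (8 * T) + 2 * T - |y c - x c| := by field_simp; ring
    linarith
  refine (Finset.sum_le_sum fun c _ => hcoord c).trans_eq ?_
  rw [Finset.sum_add_distrib, EuclideanSpace.real_norm_sq_eq, Finset.sum_div]
  simp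
  ring

theorem heatKernel_mul_exp_le {T : ℝ} (hT : 0 < T) (x y : Space d) :
    heatKernel T x y * Real.exp (∑ c, |y c - x c|)
      ≤ Real.exp (2 * d * T) * widenedHeatKernel T x y := by
  have hsplit : -‖x - y‖ ^ 2 / (4 * T) = -‖x - y‖ ^ 2 / (8 * T) - ‖x - y‖ ^ 2 / (8 * T) := by
    field_simp; ring
  unfold heatKernel widenedHeatKernel
  rw [mul_assoc, ← Real.exp_add, mul_left_comm, ← Real.exp_add]
  exact mul_le_mul_of_nonneg_left (Real.exp_le_exp.2 (by linarith [sum_abs_sub_le hT x y]))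
    (by positivity)

theorem heatKernel_le_widenedHeatKernel {T : ℝ} (hT : 0 ≤ T) (x y : Space d) :
    heatKernel T x y ≤ widenedHeatKernel T x y := by
  unfold heatKernel widenedHeatKernel
  gcongr _ * Real.exp ?_
  rw [neg_div, neg_div, neg_le_neg_iff]
  rcases hT.eq_or_lt with rfl | hT
  · simp
  · gcongr
    norm_num

theorem lintegral_bridgeMeasure (W : Measure C(ℝ≥0, Space d)) (k : ℕ) (x y : Space d)
    {F : PathSpace d β k → ℝ≥0∞} (hF : Measurable F) :
    ∫⁻ f, F f ∂bridgeMeasure W β k x y = ENNReal.ofReal (heatKernel ((k : ℝ) * β) x y)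
      * ∫⁻ w, F (bridgePath ((k : ℝ≥0) * β) x y w) ∂W := by
  rw [bridgeMeasure, lintegral_smul_measure, lintegral_map hF (measurable_bridgePath _ _ _),
    smul_eq_mul]

theorem lintegral_exp_sum_increments_le (hd : 1 ≤ d) {W : Measure C(ℝ≥0, Space d)}
    (hW : IsWienerMeasure W) {k : ℕ} (hk : 1 ≤ k) {s : ℝ≥0} (hs : s ≤ β) :
    ∫⁻ w : C(ℝ≥0, Space d), ENNReal.ofReal (Real.exp (∑ c : Fin d,
      (√2 * ∑ i ∈ Finset.range k, |(w (i * β + s)) c - (w (i * β)) c| + √2 * |w (k * β) c|))) ∂W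
      ≤ ENNReal.ofReal ((2 * Real.exp ((2 * d * √2) ^ 2 * β / 2)) ^ k) := by
  have : Nonempty (Fin d) := ⟨⟨0, hd⟩⟩
  let U : Fin d ⊕ Fin d → C(ℝ≥0, Space d) → ℝ := Sum.elim
    (fun c (w : C(ℝ≥0, Space d)) => √2 * ∑ i ∈ Finset.range k, |w (i * β + s) c - w (i * β) c|)
    (fun c (w : C(ℝ≥0, Space d)) => √2 * |w (k * β) c|)
  have happly := fun t : ℝ≥0 => measurable_apply_path_coord (d := d) t
  have hU : ∀ p, Measurable (U p) := by
    rintro (c | c)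
    · exact (Finset.measurable_fun_sum _ fun i _ =>
        ((happly _ c).sub (happly _ c)).abs).const_mul _
    · exact (happly _ c).abs.const_mul _
  have hcard : (Fintype.card (Fin d ⊕ Fin d) : ℝ) * √2 = 2 * d * √2 := by simp; ring
  have hpart : ∀ p, ∫⁻ w, ENNReal.ofReal (Real.exp (Fintype.card (Fin d ⊕ Fin d) * U p w)) ∂W
      ≤ ENNReal.ofReal ((2 * Real.exp ((2 * d * √2) ^ 2 * β / 2)) ^ k) := by
    rintro (c | c) <;> simp only [U, Sum.elim_inl, Sum.elim_inr, ← mul_assoc, hcard]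
    · exact lintegral_exp_sum_abs_increments_le (hW.brownian c).toIsPreBrownianReal
        (fun t => happly t c) hs _ k
    · refine (lintegral_exp_mul_abs_le ((hW.brownian c).hasLaw_eval (k * β)) _).trans
        (ENNReal.ofReal_le_ofReal ?_)
      rw [mul_pow (2 : ℝ), ← Real.exp_nat_mul]
      gcongr
      · exact le_self_pow₀ one_le_two (by omega)
      · exact le_of_eq (by push_cast; ring)
  simpa only [Fintype.sum_sum_type, U, Sum.elim_inl, Sum.elim_inr, ← Finset.sum_add_distrib]
    using lintegral_exp_sum_le hU hpart

/-- The growth rate per leg of the exponential moments of displacements. -/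
noncomputable def displacementRate (d : ℕ) (β : ℝ≥0) : ℝ :=
  2 * Real.exp ((2 * d * √2) ^ 2 * β / 2) * Real.exp (2 * d * β)

theorem one_le_displacementRate : 1 ≤ displacementRate d β :=
  one_le_mul_of_one_le_of_one_le
    (one_le_mul_of_one_le_of_one_le one_le_two (Real.one_le_exp (by positivity)))
    (Real.one_le_exp (by positivity))

theorem displacementRate_pos : 0 < displacementRate d β :=
  one_pos.trans_le one_le_displacementRate

theorem lintegral_exp_displacement_le (hd : 1 ≤ d) {W : Measure C(ℝ≥0, Space d)}
    (hW : IsWienerMeasure W) (hβ : 0 < β) {k : ℕ} (hk : 1 ≤ k) {s : ℝ} (hs0 : 0 ≤ s) (hs : s ≤ β)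
    (x y : Space d) :
    ∫⁻ f, ENNReal.ofReal (Real.exp (displacement s ⟨k, f⟩)) ∂bridgeMeasure W β k x y
      ≤ ENNReal.ofReal (displacementRate d β ^ k * widenedHeatKernel (k * β) x y) := by
  lift s to ℝ≥0 using hs0
  set Q : ℝ := 2 * Real.exp ((2 * d * √2) ^ 2 * β / 2) with hQ
  have hT : (0 : ℝ) < k * β := mul_pos (by positivity) hβ
  have hheat : 0 ≤ heatKernel ((k : ℝ) * β) x y := by unfold heatKernel; positivity
  have hwiener : ∫⁻ w, ENNReal.ofReal (Real.exp (displacement (s : ℝ)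
      (⟨k, bridgePath (k * β) x y w⟩ : Path d β))) ∂W
      ≤ ENNReal.ofReal (Real.exp (∑ c, |y c - x c|) * Q ^ k) := by
    rw [ENNReal.ofReal_mul (Real.exp_pos _).le]
    refine le_trans (lintegral_mono fun w => ?_) ((lintegral_const_mul' _ _
      ENNReal.ofReal_ne_top).trans_le
      (mul_le_mul_right (lintegral_exp_sum_increments_le hd hW hk hs) _))
    rw [← ENNReal.ofReal_mul (Real.exp_pos _).le, ← Real.exp_add]
    gcongr
    exact displacement_bridgePath_le hk hβ hs x y w
  rw [lintegral_bridgeMeasure W k x y (F := fun f => ENNReal.ofReal (Real.exp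
    (displacement s ⟨k, f⟩))) ((Real.measurable_exp.comp
    ((measurable_displacement s).comp (measurable_sigmaMk k))).ennreal_ofReal)]
  calc _ ≤ ENNReal.ofReal (heatKernel (k * β) x y)
        * ENNReal.ofReal (Real.exp (∑ c, |y c - x c|) * Q ^ k) := by gcongr
    _ = ENNReal.ofReal (heatKernel (k * β) x y * Real.exp (∑ c, |y c - x c|) * Q ^ k) := by
        rw [← ENNReal.ofReal_mul hheat, mul_assoc]
    _ ≤ ENNReal.ofReal (Real.exp (2 * d * (k * β)) * widenedHeatKernel (k * β) x y * Q ^ k) := by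
        exact ENNReal.ofReal_le_ofReal
          (mul_le_mul_of_nonneg_right (heatKernel_mul_exp_le hT x y) (by positivity))
    _ = _ := by
        rw [displacementRate, ← hQ, mul_pow Q, ← Real.exp_nat_mul _ k, mul_left_comm (k : ℝ)]
        congr 1
        ring

end Bridge

/-! ### Masses of the bridge measures in a box -/

section Masses

variable {d : ℕ} {β : ℝ≥0}

theorem rpow_neg_natCast_div_two {T : ℝ} (hT : 0 ≤ T) : T ^ (-(d : ℝ) / 2) = (√T)⁻¹ ^ d := by
  rw [neg_div, Real.rpow_neg hT, inv_pow, Real.sqrt_eq_rpow, ← Real.rpow_natCast,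
    ← Real.rpow_mul hT]
  ring_nf

theorem widenedHeatKernel_self {T : ℝ} (hT : 0 ≤ T) (x : Space d) :
    widenedHeatKernel T x x = (√(4 * Real.pi * T))⁻¹ ^ d := by
  rw [widenedHeatKernel, rpow_neg_natCast_div_two (by positivity)]
  simp

theorem widenedHeatKernel_add_latticePoint {T : ℝ} (hT : 0 ≤ T) (x : Space d) (s : ℝ)
    (n : Fin d → ℤ) : widenedHeatKernel T x (x + latticePoint s n)
      = (√(4 * Real.pi * T))⁻¹ ^ d * ∏ i, Real.exp (-(s ^ 2 / (8 * T)) * (n i : ℝ) ^ 2) := by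
  rw [← Real.exp_sum, widenedHeatKernel, rpow_neg_natCast_div_two (by positivity),
    sub_add_cancel_left, norm_neg, EuclideanSpace.real_norm_sq_eq, ← Finset.sum_neg_distrib,
    Finset.sum_div]
  congr 3 with i
  simp only [latticePoint]
  ring

theorem tsum_widenedHeatKernel_le {T : ℝ} (hT : 0 < T) {s : ℝ} (hs : 0 < s) (x : Space d) :
    ∑' n : Fin d → ℤ, ENNReal.ofReal (widenedHeatKernel T x (x + latticePoint s n))
      ≤ ENNReal.ofReal (((√(4 * Real.pi * T))⁻¹ + √2 * s⁻¹) ^ d) := by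
  set q : ℝ := s ^ 2 / (8 * T) with hq
  have hwidth : (√(4 * Real.pi * T))⁻¹ * √(Real.pi / q) = √2 * s⁻¹ := by
    rw [← Real.sqrt_inv, ← Real.sqrt_mul (by positivity), ← Real.sqrt_sq (inv_pos.2 hs).le,
      ← Real.sqrt_mul zero_le_two, hq]
    congr 1
    field_simp
    norm_num
  calc _ = ENNReal.ofReal ((√(4 * Real.pi * T))⁻¹ ^ d)
        * ∏ _i : Fin d, ∑' m : ℤ, ENNReal.ofReal (Real.exp (-q * (m : ℝ) ^ 2)) := by
        rw [← tsum_fin_pi_prod, ← ENNReal.tsum_mul_left]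
        refine tsum_congr fun n => ?_
        rw [widenedHeatKernel_add_latticePoint hT.le, ENNReal.ofReal_mul (by positivity),
          ENNReal.ofReal_prod_of_nonneg fun _ _ => (Real.exp_pos _).le]
    _ ≤ ENNReal.ofReal ((√(4 * Real.pi * T))⁻¹ ^ d)
        * ∏ _i : Fin d, ENNReal.ofReal (1 + √(Real.pi / q)) := by
        gcongr
        exact tsum_int_exp_neg_mul_sq_le (by positivity)
    _ = _ := by
        rw [Finset.prod_const, Finset.card_univ, Fintype.card_fin,
          ← ENNReal.ofReal_pow (by positivity), ← ENNReal.ofReal_mul (by positivity), ← mul_pow,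
          mul_add, mul_one, hwidth]

/-- The constant in `kernelBound`. -/
noncomputable def kernelConst (d : ℕ) (β : ℝ≥0) : ℝ :=
  2 ^ (d - 1) * ((√(4 * Real.pi * β))⁻¹ ^ d + √2 ^ d)

/-- The density `1 / |Λ|` of the Brownian motion on the torus at large times. There is no such
contribution to the mass of the bridge measures without periodic boundary conditions. -/
noncomputable def windingDensity (d : ℕ) (bc : BC) (a : ℝ) : ℝ :=
  match bc with
  | .per => (boxVolume d a)⁻¹
  | .zero => 0
  | .par => 0

/-- A bound on the mass of the bridge measures of length `k` from a point to itself in the box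
`[-a, a]^d`. -/
noncomputable def kernelBound (d : ℕ) (β : ℝ≥0) (bc : BC) (a : ℝ) (k : ℕ) : ℝ :=
  kernelConst d β * ((√(k : ℝ))⁻¹ + windingDensity d bc a)

theorem kernelConst_nonneg : 0 ≤ kernelConst d β := by
  unfold kernelConst
  positivity

theorem boxVolume_pos {a : ℝ} (ha : 0 < a) : 0 < boxVolume d a := by
  unfold boxVolume
  positivity

theorem windingDensity_nonneg {bc : BC} {a : ℝ} (ha : 0 < a) : 0 ≤ windingDensity d bc a := by
  cases bc
  exacts [(inv_pos.2 (boxVolume_pos ha)).le, le_rfl, le_rfl]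

theorem kernelBound_nonneg {bc : BC} {a : ℝ} (ha : 0 < a) (k : ℕ) :
    0 ≤ kernelBound d β bc a k :=
  mul_nonneg kernelConst_nonneg (add_nonneg (by positivity) (windingDensity_nonneg ha))

theorem inv_sqrt_pow_le (hd : 1 ≤ d) {k : ℕ} (hk : 1 ≤ k) :
    (√(4 * Real.pi * (k * β)))⁻¹ ^ d ≤ (√(4 * Real.pi * β))⁻¹ ^ d * (√(k : ℝ))⁻¹ := by
  have hk' : (1 : ℝ) ≤ √(k : ℝ) := Real.one_le_sqrt.2 (by exact_mod_cast hk)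
  rw [mul_left_comm, mul_comm, Real.sqrt_mul (by positivity), mul_inv, mul_pow]
  gcongr
  exact pow_le_of_le_one (by positivity) (inv_le_one_of_one_le₀ hk') (by omega)

theorem widenedHeatKernel_self_le (hd : 1 ≤ d) {bc : BC} {a : ℝ} (ha : 0 < a) {k : ℕ}
    (hk : 1 ≤ k) (x : Space d) : widenedHeatKernel (k * β) x x ≤ kernelBound d β bc a k := by
  have := windingDensity_nonneg (d := d) (bc := bc) ha
  calc _ = (√(4 * Real.pi * (k * β)))⁻¹ ^ d := widenedHeatKernel_self (by positivity) x
    _ ≤ (1 * ((√(4 * Real.pi * β))⁻¹ ^ d + 0)) * ((√(k : ℝ))⁻¹ + 0) := by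
        simpa only [one_mul, add_zero] using inv_sqrt_pow_le hd hk
    _ ≤ _ := by
        unfold kernelBound kernelConst
        gcongr
        exacts [one_le_pow₀ one_le_two, by positivity]

theorem tsum_widenedHeatKernel_le_kernelBound (hd : 1 ≤ d) (hβ : 0 < β) {a : ℝ} (ha : 0 < a)
    {k : ℕ} (hk : 1 ≤ k) (x : Space d) :
    ∑' n : Fin d → ℤ, ENNReal.ofReal (widenedHeatKernel (k * β) x (x + latticePoint (2 * a) n))
      ≤ ENNReal.ofReal (kernelBound d β .per a k) := by
  have hT : (0 : ℝ) < k * β := mul_pos (by positivity) hβ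
  refine (tsum_widenedHeatKernel_le hT (by positivity) x).trans (ENNReal.ofReal_le_ofReal ?_)
  set A : ℝ := (√(4 * Real.pi * β))⁻¹ ^ d
  calc _ ≤ 2 ^ (d - 1) * ((√(4 * Real.pi * (k * β)))⁻¹ ^ d + (√2 * (2 * a)⁻¹) ^ d) :=
        add_pow_le (by positivity) (by positivity) d
    _ ≤ 2 ^ (d - 1) * (A * (√(k : ℝ))⁻¹ + √2 ^ d * (boxVolume d a)⁻¹) := by
        rw [mul_pow, inv_pow (2 * a), boxVolume]
        gcongr
        exact inv_sqrt_pow_le hd hk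
    _ ≤ 2 ^ (d - 1) * ((A + √2 ^ d) * ((√(k : ℝ))⁻¹ + (boxVolume d a)⁻¹)) := by
        have hV := boxVolume_pos (d := d) ha
        gcongr
        rw [add_mul]
        gcongr
        · exact le_add_of_nonneg_right (by positivity)
        · exact le_add_of_nonneg_left (by positivity)
    _ = _ := by rw [kernelBound, kernelConst, windingDensity, mul_assoc]

theorem lintegral_bcBridgeMeasure_le (hd : 1 ≤ d) (hβ : 0 < β) (W : Measure C(ℝ≥0, Space d))
    (bc : BC) {a : ℝ} (ha : 0 < a) {k : ℕ} (hk : 1 ≤ k) (x : Space d) {c : ℝ} (hc : 0 ≤ c)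
    {F : PathSpace d β k → ℝ≥0∞} (hF : ∀ y, ∫⁻ f, F f ∂bridgeMeasure W β k x y
      ≤ ENNReal.ofReal (c * widenedHeatKernel (k * β) x y)) :
    ∫⁻ f, F f ∂bcBridgeMeasure W β bc a k x x ≤ ENNReal.ofReal (c * kernelBound d β bc a k) := by
  have hrestrict (A : Set (PathSpace d β k)) (bc : BC) :
      ∫⁻ f in A, F f ∂bridgeMeasure W β k x x ≤ ENNReal.ofReal (c * kernelBound d β bc a k) :=
    (setLIntegral_le_lintegral _ _).trans ((hF x).trans (ENNReal.ofReal_le_ofReal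
      (mul_le_mul_of_nonneg_left (widenedHeatKernel_self_le hd ha hk x) hc)))
  cases bc with
  | per =>
    rw [bcBridgeMeasure, lintegral_sum_measure, ENNReal.ofReal_mul hc]
    refine (ENNReal.tsum_le_tsum fun n => (hF _).trans_eq (ENNReal.ofReal_mul hc)).trans ?_
    rw [ENNReal.tsum_mul_left]
    gcongr
    exact tsum_widenedHeatKernel_le_kernelBound hd hβ ha hk x
  | zero => exact hrestrict _ _
  | par => exact hrestrict _ _

theorem IsWienerMeasure.isProbabilityMeasure {W : Measure C(ℝ≥0, Space d)} (hd : 1 ≤ d)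
    (hW : IsWienerMeasure W) : IsProbabilityMeasure W :=
  (hW.brownian ⟨0, hd⟩).toIsPreBrownianReal.hasLaw_eval 0 |>.isProbabilityMeasure

theorem IsWienerMeasure.ae_bridgePath_eval_zero {W : Measure C(ℝ≥0, Space d)}
    (hW : IsWienerMeasure W) (k : ℕ) (x y : Space d) :
    ∀ᵐ w ∂W, Path.eval (⟨k, bridgePath (k * β) x y w⟩ : Path d β) 0 = x := by
  have hzero : ∀ᵐ w ∂W, ∀ c, w 0 c = 0 :=
    ae_all_iff.2 fun c => (hW.brownian c).toIsPreBrownianReal.eval_zero_ae_eq_zero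
  filter_upwards [hzero] with w hw
  have heval := eval_of_le (bridgePath (k * β) x y w) (zero_le : 0 ≤ (k * β : ℝ≥0))
  rw [NNReal.coe_zero] at heval
  rw [heval]
  ext c
  rw [bridgePath_apply]
  simp [hw c]

theorem lintegral_eval_zero_le (hd : 1 ≤ d) {W : Measure C(ℝ≥0, Space d)}
    (hW : IsWienerMeasure W) (k : ℕ) (x y : Space d) {G : Space d → ℝ≥0∞} (hG : Measurable G) :
    ∫⁻ f : PathSpace d β k, G (Path.eval ⟨k, f⟩ 0) ∂bridgeMeasure W β k x y
      ≤ G x * ENNReal.ofReal (widenedHeatKernel (k * β) x y) := by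
  have := hW.isProbabilityMeasure hd
  rw [lintegral_bridgeMeasure W k x y (F := fun f => G (Path.eval ⟨k, f⟩ 0))
    (hG.comp (measurable_eval k 0)), mul_comm]
  refine mul_le_mul' (le_of_eq ?_) (ENNReal.ofReal_le_ofReal
    (heatKernel_le_widenedHeatKernel (by positivity) x y))
  calc _ = ∫⁻ _, G x ∂W := lintegral_congr_ae <| by
        filter_upwards [hW.ae_bridgePath_eval_zero (β := β) k x y] with w hw
        rw [hw]
    _ = G x := by simp

theorem lintegral_bridgeMeasure_const_le (hd : 1 ≤ d) {W : Measure C(ℝ≥0, Space d)}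
    (hW : IsWienerMeasure W) (k : ℕ) (x y : Space d) {c : ℝ} (hc : 0 ≤ c) :
    ∫⁻ _, ENNReal.ofReal c ∂bridgeMeasure W β k x y
      ≤ ENNReal.ofReal (c * widenedHeatKernel (k * β) x y) := by
  rw [ENNReal.ofReal_mul hc]
  exact lintegral_eval_zero_le hd hW k x y (G := fun _ => ENNReal.ofReal c) measurable_const

end Masses

/-! ### The potential in the box -/

section Potential

variable {d : ℕ} {v : Space d → ℝ}

theorem finite_lattice_near (hv : HasCompactSupport v) {a : ℝ} (ha : 0 < a) (y : Space d) :
    {n : Fin d → ℤ | ∃ z ∈ Metric.ball y 1, v (z + latticePoint (2 * a) n) ≠ 0}.Finite := by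
  obtain ⟨R, hR⟩ := hv.isBounded.subset_closedBall 0
  set M : ℤ := ⌈(R + (1 + ‖y‖)) / (2 * a)⌉
  refine (Set.finite_Icc (fun _ : Fin d => -M) (fun _ => M)).subset ?_
  rintro n ⟨z, hz, hn⟩
  have hsum : ‖z + latticePoint (2 * a) n‖ ≤ R := by
    simpa only [mem_closedBall_zero_iff] using hR (subset_tsupport v hn)
  have hz_norm : ‖z‖ ≤ 1 + ‖y‖ := by
    have hdist : ‖z - y‖ < 1 := by rwa [mem_ball_iff_norm] at hz
    linarith [norm_le_norm_add_norm_sub' z y]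
  have hlattice : ‖latticePoint (2 * a) n‖ ≤ R + (1 + ‖y‖) := by
    calc _ = ‖z + latticePoint (2 * a) n - z‖ := by rw [add_sub_cancel_left]
      _ ≤ _ := (norm_sub_le _ _).trans (add_le_add hsum hz_norm)
  have hcoord (i : Fin d) : |n i| ≤ M := by
    have habs : |2 * a * (n i : ℝ)| ≤ R + (1 + ‖y‖) :=
      (PiLp.norm_apply_le (latticePoint (2 * a) n) i).trans hlattice
    rw [abs_mul, abs_of_pos (by positivity)] at habs
    have : |(n i : ℝ)| ≤ M :=
      ((le_div_iff₀ (by positivity)).2 (by linarith)).trans (Int.le_ceil _)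
    exact_mod_cast this
  exact ⟨fun i => (abs_le.1 (hcoord i)).1, fun i => (abs_le.1 (hcoord i)).2⟩

theorem finite_support_lattice (hv : HasCompactSupport v) {a : ℝ} (ha : 0 < a) (y : Space d) :
    (Function.support fun n : Fin d → ℤ => v (y + latticePoint (2 * a) n)).Finite :=
  (finite_lattice_near hv ha y).subset fun _ hn => ⟨y, Metric.mem_ball_self one_pos, hn⟩

theorem continuous_bcPotential (hv : AssumptionV v) (bc : BC) {a : ℝ} (ha : 0 < a) :
    Continuous (bcPotential bc a v) := by
  cases bc with
  | per =>
    have hfinsum : bcPotential .per a v =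
        fun y => ∑ᶠ n : Fin d → ℤ, v (y + latticePoint (2 * a) n) :=
      funext fun y => tsum_eq_finsum (finite_support_lattice hv.compactSupport ha y)
    rw [hfinsum]
    refine continuous_finsum (fun n => hv.continuous.comp (continuous_id.add continuous_const))
      fun y => ⟨Metric.ball y 1, Metric.ball_mem_nhds y one_pos, ?_⟩
    exact (finite_lattice_near hv.compactSupport ha y).subset
      fun n ⟨z, hz, hz_ball⟩ => ⟨z, hz_ball, hz⟩
  | zero => exact hv.continuous
  | par => exact hv.continuous

theorem bcPotential_nonneg (hv : AssumptionV v) (bc : BC) (a : ℝ) (y : Space d) :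
    0 ≤ bcPotential bc a v y := by
  cases bc with
  | per => exact tsum_nonneg fun n => hv.nonneg _
  | zero => exact hv.nonneg y
  | par => exact hv.nonneg y

theorem le_bcPotential (hv : AssumptionV v) (bc : BC) {a : ℝ} (ha : 0 < a) (z y y' : Space d) :
    v (z + (position bc a y - y) - (position bc a y' - y')) ≤ bcPotential bc a v z := by
  cases bc with
  | per =>
    have hs : Summable fun n : Fin d → ℤ => v (z + latticePoint (2 * a) n) :=
      summable_of_hasFiniteSupport (finite_support_lattice hv.compactSupport ha z)
    refine le_trans (le_of_eq ?_) (hs.le_tsum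
      (fun i => ⌊(y' i + a) / (2 * a)⌋ - ⌊(y i + a) / (2 * a)⌋) fun n _ => hv.nonneg _)
    congr 1
    ext i
    simp [position, latticePoint]
    ring
  | zero => simp [position, bcPotential]
  | par => simp [position, bcPotential]

theorem position_per_mem_cube {a : ℝ} (ha : 0 < a) (y : Space d) :
    position .per a y ∈ cube (0 : Space d) a := by
  intro i
  have hlower := Int.floor_le ((y i + a) / (2 * a))
  have hupper := Int.lt_floor_add_one ((y i + a) / (2 * a))
  rw [le_div_iff₀ (by positivity)] at hlower
  rw [div_lt_iff₀ (by positivity)] at hupper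
  simp only [position, PiLp.zero_apply, sub_zero, abs_le]
  constructor <;> linarith

end Potential

/-! ### Lower bounds on the energy -/

section Energy

variable {d : ℕ} {β : ℝ≥0} {v : Space d → ℝ}

/-- The energy `∑_{i < j} V(u_i - u_j)` of the points `u_i`, `i ∈ I`. The sum runs over ordered
pairs since `V` need not be even. -/
noncomputable def pairEnergy {ι : Type*} [DecidableEq ι] (V : Space d → ℝ) (I : Finset ι)
    (u : ι → Space d) : ℝ :=
  1 / 2 * ∑ p ∈ I.offDiag, V (u p.1 - u p.2)

theorem pairEnergy_nonneg {ι : Type*} [DecidableEq ι] {V : Space d → ℝ} (hV : ∀ y, 0 ≤ V y)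
    (I : Finset ι) (u : ι → Space d) : 0 ≤ pairEnergy V I u :=
  mul_nonneg (by norm_num) (Finset.sum_nonneg fun _ _ => hV _)

theorem pairEnergy_map {ι κ : Type*} [DecidableEq ι] [DecidableEq κ] (V : Space d → ℝ)
    (I : Finset κ) (e : κ ↪ ι) (u : ι → Space d) :
    pairEnergy V (I.map e) u = pairEnergy V I (u ∘ e) := by
  have hmap : (I.map e).offDiag = I.offDiag.map (e.prodMap e) := by
    ext ⟨i, j⟩
    simp only [Finset.mem_offDiag, Finset.mem_map, Prod.exists, Function.Embedding.coe_prodMap,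
      Prod.map_apply, Prod.mk.injEq]
    constructor
    · rintro ⟨⟨i, hi, rfl⟩, ⟨j, hj, rfl⟩, hij⟩
      exact ⟨i, j, ⟨hi, hj, fun h => hij (h ▸ rfl)⟩, rfl, rfl⟩
    · rintro ⟨i, j, ⟨hi, hj, hij⟩, rfl, rfl⟩
      exact ⟨⟨i, hi, rfl⟩, ⟨j, hj, rfl⟩, e.injective.ne hij⟩
  rw [pairEnergy, hmap, Finset.sum_map]
  rfl

theorem sum_offDiag_eq_sum_ite {ι M : Type*} [DecidableEq ι] [AddCommMonoid M] (I : Finset ι)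
    (g : ι → ι → M) :
    ∑ p ∈ I.offDiag, g p.1 p.2 = ∑ i ∈ I, ∑ j ∈ I, if i ≠ j then g i j else 0 := by
  rw [← Finset.sum_product', ← Finset.sum_filter]
  refine Finset.sum_congr (Finset.ext fun p => ?_) fun _ _ => rfl
  simp only [Finset.mem_offDiag, Finset.mem_filter, Finset.mem_product, and_assoc]

theorem sum_offDiag_fin {N : ℕ} (g : Fin N → Fin N → ℝ) :
    ∑ p ∈ (Finset.univ : Finset (Fin N)).offDiag, g p.1 p.2
      = ∑ p, ∑ q with p < q, g p q + ∑ p : Fin N, ∑ q with p < q, g p.rev q.rev := by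
  have hrev : ∑ p : Fin N, ∑ q with p < q, g p.rev q.rev = ∑ p, ∑ q with q < p, g p q := by
    refine Fintype.sum_equiv Fin.revPerm _ _ fun p => ?_
    rw [Finset.sum_filter, Finset.sum_filter]
    exact Fintype.sum_equiv Fin.revPerm _ _ fun q => by simp
  rw [hrev, sum_offDiag_eq_sum_ite, ← Finset.sum_add_distrib]
  refine Finset.sum_congr rfl fun p _ => ?_
  rw [Finset.sum_filter, Finset.sum_filter, ← Finset.sum_add_distrib]
  refine Finset.sum_congr rfl fun q _ => ?_
  rcases lt_trichotomy p q with h | rfl | h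
  · simp [h, h.not_gt, h.ne]
  · simp
  · simp [h, h.not_gt, h.ne']

/-- Superstability with constant `C` for points in cubes of arbitrary position. -/
def SuperstableOnCubes (C : ℝ) (v : Space d → ℝ) : Prop :=
  ∀ (I : Finset ℕ) (u : ℕ → Space d) (z : Space d) (b : ℝ), 1 ≤ b → (∀ i ∈ I, u i ∈ cube z b) →
    C * ((I.card : ℝ) ^ 2 / (2 * b) ^ d - I.card) ≤ pairEnergy v I u

theorem AssumptionV.exists_superstableOnCubes (hv : AssumptionV v) :
    ∃ C > 0, SuperstableOnCubes C v := by
  obtain ⟨C, hC0, hC⟩ := hv.superstable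
  refine ⟨C, hC0, fun I u z b hb hu => ?_⟩
  set e := I.orderEmbOfFin rfl with he
  have hbox (σ : Fin I.card → Fin I.card) : C * ((I.card : ℝ) ^ 2 / (2 * b) ^ d - I.card)
      ≤ ∑ p, ∑ q with p < q, v (u (e (σ p)) - u (e (σ q))) := by
    have hprod : ∏ _i : Fin d, (b - -b) = (2 * b) ^ d := by
      rw [Finset.prod_const, Finset.card_univ, Fintype.card_fin, sub_neg_eq_add, two_mul]
    simpa only [hprod, sub_sub_sub_cancel_right] using
      hC (fun _ => -b) (fun _ => b) (fun _ => ⟨by linarith, hb⟩) I.card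
        (fun p => u (e (σ p)) - z) fun p i => abs_le.1 (hu _ (I.orderEmbOfFin_mem rfl _) i)
  have hmap : I = Finset.univ.map e.toEmbedding := by simp [he]
  calc _ ≤ 1 / 2 * (∑ p, ∑ q with p < q, v (u (e p) - u (e q))
        + ∑ p : Fin I.card, ∑ q with p < q, v (u (e p.rev) - u (e q.rev))) := by
        have hid := hbox id
        have hrev := hbox Fin.rev
        simp only [id] at hid
        linarith
    _ = pairEnergy v (Finset.univ.map e.toEmbedding) u := by
        rw [pairEnergy_map, pairEnergy, ← sum_offDiag_fin fun p q => v (u (e p) - u (e q))]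
        rfl
    _ = _ := by rw [← hmap]

/-- The interaction of the different legs of a path with each other. -/
noncomputable def selfEnergy (V : Space d → ℝ) (f : Path d β) : ℝ :=
  ∫ s in (0 : ℝ)..β, pairEnergy V (Finset.range f.1) fun i => f.eval (i * β + s)

theorem continuous_pairEnergy_eval {V : Space d → ℝ} (hV : Continuous V) (f : Path d β) :
    Continuous fun s : ℝ => pairEnergy V (Finset.range f.1) fun i => f.eval (i * β + s) := by
  have heval := continuous_eval f
  unfold pairEnergy
  fun_prop

theorem selfEnergy_nonneg {V : Space d → ℝ} (hV : ∀ y, 0 ≤ V y) (f : Path d β) :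
    0 ≤ selfEnergy V f :=
  intervalIntegral.integral_nonneg β.2 fun _ _ => pairEnergy_nonneg hV _ _

theorem legInteraction_nonneg {V : Space d → ℝ} (hV : ∀ y, 0 ≤ V y) (f g : Path d β) (i j : ℕ) :
    0 ≤ legInteraction V f g i j :=
  intervalIntegral.integral_nonneg β.2 fun _ _ => hV _

theorem selfEnergy_eq_sum_legInteraction {V : Space d → ℝ} (hV : Continuous V) (f : Path d β) :
    selfEnergy V f = 1 / 2 * ∑ i ∈ Finset.range f.1, ∑ j ∈ Finset.range f.1,
      if i ≠ j then legInteraction V f f i j else 0 := by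
  have heval := continuous_eval f
  unfold selfEnergy pairEnergy legInteraction
  rw [intervalIntegral.integral_const_mul, intervalIntegral.integral_finsetSum fun p _ =>
    Continuous.intervalIntegrable (by fun_prop) _ _]
  exact congrArg _ (sum_offDiag_eq_sum_ite _ fun i j : ℕ =>
    ∫ s in (0 : ℝ)..β, V (f.eval (i * β + s) - f.eval (j * β + s)))

theorem sum_selfEnergy_le_interaction {V : Space d → ℝ} (hV : Continuous V)
    (hV0 : ∀ y, 0 ≤ V y) (ω : Config (MarkedPoint d β)) :
    ∑ p, selfEnergy V (ω.2 p).2 ≤ interaction V ω := by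
  refine Finset.sum_le_sum fun p _ => ?_
  refine (le_of_eq ?_).trans (Finset.single_le_sum (fun q _ => ?_) (Finset.mem_univ p))
  · simp only [selfEnergy_eq_sum_legInteraction hV, ne_eq, Prod.mk.injEq, true_and]
  · refine mul_nonneg (by norm_num) (Finset.sum_nonneg fun i _ => Finset.sum_nonneg fun j _ => ?_)
    split_ifs
    exacts [legInteraction_nonneg hV0 _ _ _ _, le_rfl]

/-- On the torus, the points may be moved by periods of the points `w i` to satisfy the hypothesis
of the superstability bound. -/
theorem SuperstableOnCubes.le_pairEnergy_bcPotential {C : ℝ} (hC : SuperstableOnCubes C v)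
    (hv : AssumptionV v) (bc : BC) {a : ℝ} (ha : 0 < a) {I J : Finset ℕ} (hI : I ⊆ J)
    (u w : ℕ → Space d) (z : Space d) {b : ℝ} (hb : 1 ≤ b)
    (hu : ∀ i ∈ I, u i + (position bc a (w i) - w i) ∈ cube z b) :
    C * ((I.card : ℝ) ^ 2 / (2 * b) ^ d - I.card) ≤ pairEnergy (bcPotential bc a v) J u := by
  refine (hC I _ z b hb hu).trans (mul_le_mul_of_nonneg_left ?_ (by norm_num))
  refine le_trans (Finset.sum_le_sum fun p _ => ?_) (Finset.sum_le_sum_of_subset_of_nonneg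
    (Finset.offDiag_mono hI) fun p _ _ => bcPotential_nonneg hv bc a _)
  rw [add_sub_add_comm, ← add_sub_assoc]
  exact le_bcPotential hv bc ha (u p.1 - u p.2) (w p.1) (w p.2)

variable {C : ℝ}

theorem selfEnergy_per_ge (hv : AssumptionV v) (hC : SuperstableOnCubes C v) {a : ℝ} (ha : 1 ≤ a)
    (f : Path d β) :
    β * (C * ((f.1 : ℝ) ^ 2 / boxVolume d a - f.1)) ≤ selfEnergy (bcPotential .per a v) f := by
  have ha0 : 0 < a := by linarith
  have hpointwise (s : ℝ) : C * ((f.1 : ℝ) ^ 2 / boxVolume d a - f.1)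
      ≤ pairEnergy (bcPotential .per a v) (Finset.range f.1) fun i => f.eval (i * β + s) := by
    have h := hC.le_pairEnergy_bcPotential hv .per ha0 (Finset.Subset.refl (Finset.range f.1))
      (fun i => f.eval (i * β + s)) (fun i => f.eval (i * β + s)) 0 ha fun i _ => by
        rw [add_sub_cancel]
        exact position_per_mem_cube ha0 _
    rwa [Finset.card_range] at h
  calc _ = ∫ _s in (0 : ℝ)..β, C * ((f.1 : ℝ) ^ 2 / boxVolume d a - f.1) := by
        rw [intervalIntegral.integral_const, sub_zero, smul_eq_mul]
    _ ≤ _ := intervalIntegral.integral_mono_on β.2 (by simp)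
        ((continuous_pairEnergy_eval (continuous_bcPotential hv .per ha0) f).intervalIntegrable
          _ _) fun s _ => hpointwise s

/-- The displacement of a single leg. -/
noncomputable def legDisplacement (f : Path d β) (s : ℝ) (i : ℕ) : ℝ :=
  ∑ c, |f.eval (i * β + s) c - f.eval (i * β) c|

theorem legDisplacement_nonneg (f : Path d β) (s : ℝ) (i : ℕ) : 0 ≤ legDisplacement f s i :=
  Finset.sum_nonneg fun _ _ => abs_nonneg _

theorem le_card_legDisplacement_le (f : Path d β) (s : ℝ) {D : ℝ} (hD : 0 < D) :
    f.1 - displacement s f / D ≤ {i ∈ Finset.range f.1 | legDisplacement f s i ≤ D}.card := by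
  have hcomplement :
      ({i ∈ Finset.range f.1 | ¬ legDisplacement f s i ≤ D}.card : ℝ) * D ≤ displacement s f := by
    rw [← nsmul_eq_mul]
    refine (Finset.card_nsmul_le_sum _ (legDisplacement f s) D fun i hi =>
      (not_le.1 (Finset.mem_filter.1 hi).2).le).trans ?_
    exact Finset.sum_le_sum_of_subset_of_nonneg (Finset.filter_subset _ _)
      fun i _ _ => legDisplacement_nonneg f s i
  have hcard := Finset.card_filter_add_card_filter_not (s := Finset.range f.1)
    (fun i => legDisplacement f s i ≤ D)
  rw [Finset.card_range] at hcard
  rw [sub_le_iff_le_add, ← sub_le_iff_le_add', le_div_iff₀ hD]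
  refine le_trans (mul_le_mul_of_nonneg_right (le_of_eq ?_) hD.le) hcomplement
  rw [sub_eq_iff_eq_add']
  exact_mod_cast hcard.symm

theorem pairEnergy_nonCrossing_ge (hv : AssumptionV v) (hC0 : 0 ≤ C) (hC : SuperstableOnCubes C v)
    (bc : BC) {a : ℝ} (ha : 0 < a) {r D : ℝ} (hr : 0 ≤ r) (hD : 1 ≤ D) {f : Path d β}
    (hf : NonCrossing bc a r f) (s : ℝ) :
    C * ((3 / 4 * (f.1 : ℝ) ^ 2 - f.1 / D * displacement s f) / (2 * (r + D)) ^ d - f.1)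
      ≤ pairEnergy (bcPotential bc a v) (Finset.range f.1) fun i => f.eval (i * β + s) := by
  obtain ⟨n, hn⟩ := hf
  set I := {i ∈ Finset.range f.1 | legDisplacement f s i ≤ D}
  have hcube : ∀ i ∈ I, f.eval (i * β + s) + (position bc a (f.eval (i * β)) - f.eval (i * β))
      ∈ cube (latticePoint (2 * r) n) (r + D) := by
    intro i hi c
    obtain ⟨hik, hiD⟩ := Finset.mem_filter.1 hi
    have hstart := hn i (Finset.mem_range.1 hik) c
    have hleg : |f.eval (i * β + s) c - f.eval (i * β) c| ≤ D :=
      (Finset.single_le_sum (f := fun c => |f.eval (i * β + s) c - f.eval (i * β) c|)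
        (fun c _ => abs_nonneg _) (Finset.mem_univ c)).trans hiD
    refine le_trans (le_of_eq ?_) ((abs_add_le _ _).trans (add_le_add hstart hleg))
    simp only [PiLp.add_apply, PiLp.sub_apply]
    ring_nf
  have hlower := le_card_legDisplacement_le f s (D := D) (by linarith)
  have hupper : (I.card : ℝ) ≤ f.1 := by
    exact_mod_cast (Finset.card_filter_le _ _).trans_eq (Finset.card_range f.1)
  have hsquare : 3 / 4 * (f.1 : ℝ) ^ 2 - f.1 / D * displacement s f ≤ (I.card : ℝ) ^ 2 := by
    calc _ = f.1 * (f.1 - displacement s f / D) - (f.1 / 2 : ℝ) ^ 2 := by ring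
      _ ≤ f.1 * I.card - (f.1 / 2 : ℝ) ^ 2 := by gcongr
      _ ≤ _ := by linarith [sq_nonneg ((I.card : ℝ) - f.1 / 2)]
  calc _ ≤ C * ((I.card : ℝ) ^ 2 / (2 * (r + D)) ^ d - I.card) := by gcongr
    _ ≤ _ := hC.le_pairEnergy_bcPotential hv bc ha (Finset.filter_subset _ _)
        (fun i => f.eval (i * β + s)) (fun i => f.eval (i * β)) _ (by linarith) hcube

/-- The average of the displacement over the time. -/
noncomputable def meanDisplacement (f : Path d β) : ℝ :=
  ⨍ s in Set.Ioc (0 : ℝ) β, displacement s f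

/-- The average over the time of the exponential of the displacement. -/
noncomputable def meanExpDisplacement (f : Path d β) : ℝ≥0∞ :=
  ⨍⁻ s in Set.Ioc (0 : ℝ) β, ENNReal.ofReal (Real.exp (displacement s f)) ∂volume

theorem integral_displacement (f : Path d β) :
    ∫ s in (0 : ℝ)..β, displacement s f = β * meanDisplacement f := by
  rw [meanDisplacement, intervalIntegral.integral_of_le β.coe_nonneg,
    ← measure_smul_setAverage _ (by simp)]
  simp

theorem ofReal_exp_meanDisplacement_le (hβ : 0 < β) (f : Path d β) :
    ENNReal.ofReal (Real.exp (meanDisplacement f)) ≤ meanExpDisplacement f := by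
  have hvol : volume (Set.Ioc (0 : ℝ) β) ≠ 0 := by simpa using hβ.ne'
  have hdisp := continuous_displacement f
  have hexp : IntegrableOn (fun s => Real.exp (displacement s f)) (Set.Ioc (0 : ℝ) β) :=
    (Continuous.integrableOn_Icc (by fun_prop)).mono_set Set.Ioc_subset_Icc_self
  rw [meanExpDisplacement, setLAverage_eq, ← ofReal_setAverage hexp
    (Filter.Eventually.of_forall fun _ => (Real.exp_pos _).le)]
  exact ENNReal.ofReal_le_ofReal (convexOn_exp.map_set_average_le Real.continuous_exp.continuousOn
    isClosed_univ hvol (by simp) (by simp)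
    (hdisp.integrableOn_Icc.mono_set Set.Ioc_subset_Icc_self) hexp)

theorem selfEnergy_nonCrossing_ge (hv : AssumptionV v) (hC0 : 0 ≤ C) (hC : SuperstableOnCubes C v)
    (bc : BC) {a : ℝ} (ha : 0 < a) {r D : ℝ} (hr : 0 ≤ r) (hD : 1 ≤ D) {f : Path d β}
    (hf : NonCrossing bc a r f) :
    β * (C * ((3 / 4 * (f.1 : ℝ) ^ 2 - f.1 / D * meanDisplacement f) / (2 * (r + D)) ^ d - f.1))
      ≤ selfEnergy (bcPotential bc a v) f := by
  have hdisp := continuous_displacement f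
  calc _ = ∫ s in (0 : ℝ)..β,
        (C * (3 / 4 * (f.1 : ℝ) ^ 2 / (2 * (r + D)) ^ d - f.1)
          - C * (f.1 / D) / (2 * (r + D)) ^ d * displacement s f) := by
        rw [intervalIntegral.integral_sub (by simp)
          ((hdisp.intervalIntegrable _ _).const_mul _), intervalIntegral.integral_const,
          intervalIntegral.integral_const_mul, integral_displacement, sub_zero, smul_eq_mul]
        ring
    _ ≤ _ := intervalIntegral.integral_mono_on β.2
        (Continuous.intervalIntegrable (by fun_prop) _ _)
        ((continuous_pairEnergy_eval (continuous_bcPotential hv bc ha) f).intervalIntegrable _ _)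
        fun s _ => le_of_eq_of_le (by ring) (pairEnergy_nonCrossing_ge hv hC0 hC bc ha hr hD hf s)

/-- If the average displacement is small, the self-energy wins over `θ ℓ(f)`, otherwise the
exponential of the displacement does. -/
theorem exp_sub_selfEnergy_nonCrossing_le (hv : AssumptionV v) (hC0 : 0 ≤ C)
    (hC : SuperstableOnCubes C v) (bc : BC) {a : ℝ} (ha : 0 < a) (hβ : 0 < β) {r D θ : ℝ}
    (hr : 0 ≤ r) (hD : 1 ≤ D) {f : Path d β} (hf : NonCrossing bc a r f)
    (hθ : θ ≤ β * (C * (1 / 2 * (f.1 : ℝ) / (2 * (r + D)) ^ d - 1))) :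
    ENNReal.ofReal (Real.exp (θ * f.1 - selfEnergy (bcPotential bc a v) f))
      ≤ 1 + ENNReal.ofReal (Real.exp ((θ - D / 4) * f.1)) * meanExpDisplacement f := by
  have : 0 < D := by linarith
  set m := meanDisplacement f
  rcases le_or_gt m (D / 4 * f.1) with hcase | hcase
  · refine le_trans ?_ le_self_add
    rw [ENNReal.ofReal_le_one, Real.exp_le_one_iff, sub_nonpos]
    refine le_trans ?_ (selfEnergy_nonCrossing_ge hv hC0 hC bc ha hr hD hf)
    calc θ * f.1 ≤ β * (C * (1 / 2 * (f.1 : ℝ) / (2 * (r + D)) ^ d - 1)) * f.1 := by gcongr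
      _ = β * (C * ((3 / 4 * (f.1 : ℝ) ^ 2 - f.1 / D * (D / 4 * f.1)) / (2 * (r + D)) ^ d
            - f.1)) := by
          field_simp
          ring
      _ ≤ _ := by gcongr
  · refine le_trans ?_ le_add_self
    calc _ ≤ ENNReal.ofReal (Real.exp ((θ - D / 4) * f.1) * Real.exp m) := by
          rw [← Real.exp_add]
          gcongr
          linarith [selfEnergy_nonneg (bcPotential_nonneg hv bc a) f]
      _ ≤ _ := by
          rw [ENNReal.ofReal_mul (Real.exp_pos _).le]
          gcongr
          exact ofReal_exp_meanDisplacement_le hβ f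

end Energy

/-! ### The mass of the loop soup -/

section Soup

variable {d : ℕ} {β : ℝ≥0}

theorem cube_eq_preimage_closedBall (c : Space d) {r : ℝ} (hr : 0 ≤ r) :
    cube c r = WithLp.ofLp ⁻¹' Metric.closedBall (WithLp.ofLp c) r := by
  ext y
  simp only [cube, Set.mem_ofPred_eq, Set.mem_preimage, Metric.mem_closedBall, dist_pi_le_iff hr,
    Real.dist_eq]

theorem volume_cube (c : Space d) {r : ℝ} (hr : 0 ≤ r) :
    volume (cube c r) = ENNReal.ofReal (boxVolume d r) := by
  rw [cube_eq_preimage_closedBall c hr, (PiLp.volume_preserving_ofLp (Fin d)).measure_preimage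
    Metric.isClosed_closedBall.nullMeasurableSet, Real.volume_pi_closedBall _ hr,
    Fintype.card_fin, boxVolume]

/-- The integral of `F` over the loops of length `k` that start in the box `[-a, a]^d`. -/
noncomputable def loopIntegral (W : Measure C(ℝ≥0, Space d)) (bc : BC) (a : ℝ) (k : ℕ)
    (F : Path d β → ℝ≥0∞) : ℝ≥0∞ :=
  ∫⁻ x in cube (0 : Space d) a, ∫⁻ f, F ⟨k, f⟩ ∂bcBridgeMeasure W β bc a k x x

theorem lintegral_intensity_le (W : Measure C(ℝ≥0, Space d)) (bc : BC) (a : ℝ)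
    (F : Path d β → ℝ≥0∞) :
    ∫⁻ z, F z.2 ∂intensity W β bc a ≤ ∑' k : ℕ+, (k : ℝ≥0∞)⁻¹ * loopIntegral W bc a k F := by
  unfold intensity
  rw [lintegral_sum_measure]
  refine ENNReal.tsum_le_tsum fun k => ?_
  rw [lintegral_smul_measure, smul_eq_mul]
  refine mul_le_mul_right ((Measure.lintegral_bind_le _ _ _).trans (lintegral_mono fun x => ?_)) _
  exact lintegral_map_le _ _

theorem loopIntegral_const_le (hd : 1 ≤ d) (hβ : 0 < β) {W : Measure C(ℝ≥0, Space d)}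
    (hW : IsWienerMeasure W) (bc : BC) {a : ℝ} (ha : 0 < a) {k : ℕ} (hk : 1 ≤ k) {c : ℝ}
    (hc : 0 ≤ c) :
    loopIntegral (β := β) W bc a k (fun _ => ENNReal.ofReal c)
      ≤ ENNReal.ofReal (boxVolume d a * (c * kernelBound d β bc a k)) := by
  calc _ ≤ ∫⁻ _ in cube (0 : Space d) a, ENNReal.ofReal (c * kernelBound d β bc a k) :=
        lintegral_mono fun x => lintegral_bcBridgeMeasure_le hd hβ W bc ha hk x hc fun y =>
          lintegral_bridgeMeasure_const_le hd hW k x y hc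
    _ = _ := by
        rw [setLIntegral_const, volume_cube _ ha.le, mul_comm,
          ENNReal.ofReal_mul (boxVolume_pos ha).le]

theorem loopIntegral_one_add_le (hd : 1 ≤ d) (hβ : 0 < β) {W : Measure C(ℝ≥0, Space d)}
    (hW : IsWienerMeasure W) (bc : BC) {a : ℝ} (ha : 0 < a) {k : ℕ} (hk : 1 ≤ k)
    (X : Path d β → ℝ≥0∞) :
    loopIntegral W bc a k (fun f => 1 + X f)
      ≤ ENNReal.ofReal (boxVolume d a * kernelBound d β bc a k) + loopIntegral W bc a k X := by
  calc _ = ∫⁻ x in cube (0 : Space d) a, (∫⁻ _, 1 ∂bcBridgeMeasure W β bc a k x x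
        + ∫⁻ f, X ⟨k, f⟩ ∂bcBridgeMeasure W β bc a k x x) :=
        lintegral_congr fun x => lintegral_add_left measurable_const _
    _ ≤ ∫⁻ x in cube (0 : Space d) a, (ENNReal.ofReal (1 * kernelBound d β bc a k)
        + ∫⁻ f, X ⟨k, f⟩ ∂bcBridgeMeasure W β bc a k x x) := by
        gcongr with x
        refine lintegral_bcBridgeMeasure_le hd hβ W bc ha hk x zero_le_one fun y => ?_
        simpa only [ENNReal.ofReal_one] using
          lintegral_bridgeMeasure_const_le hd hW k x y zero_le_one
    _ = _ := by
        rw [lintegral_add_left measurable_const, setLIntegral_const, volume_cube _ ha.le, one_mul,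
          mul_comm, ← ENNReal.ofReal_mul (boxVolume_pos ha).le, loopIntegral]

theorem sigmaFinite_intensity (hd : 1 ≤ d) (hβ : 0 < β) {W : Measure C(ℝ≥0, Space d)}
    (hW : IsWienerMeasure W) (bc : BC) {a : ℝ} (ha : 0 < a) : SigmaFinite (intensity W β bc a) := by
  have hlength : Measurable fun z : MarkedPoint d β => z.2.1 :=
    (measurable_of_comp_sigmaMk fun _ => measurable_const).comp measurable_snd
  refine ⟨⟨⟨fun n => {z | z.2.1 ≤ n}, fun _ => trivial, fun n => ?_,
    Set.iUnion_eq_univ_iff.2 fun z => ⟨z.2.1, le_refl z.2.1⟩⟩⟩⟩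
  have hmeas : MeasurableSet {z : MarkedPoint d β | z.2.1 ≤ n} := hlength measurableSet_Iic
  rw [← lintegral_indicator_one hmeas]
  simp only [Set.indicator_apply, Set.mem_ofPred_eq, Pi.one_apply]
  refine (lintegral_intensity_le W bc a fun f => if f.1 ≤ n then 1 else 0).trans_lt ?_
  rw [tsum_eq_sum (s := Finset.Icc 1 n.succPNat) fun k hk => ?_]
  · refine ENNReal.sum_lt_top.2 fun k _ => ENNReal.mul_lt_top ?_ ?_
    · exact ENNReal.inv_lt_top.2 (by exact_mod_cast k.pos)
    · refine lt_of_le_of_lt ?_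
        ((loopIntegral_const_le hd hβ hW bc ha k.pos zero_le_one).trans_lt ENNReal.ofReal_lt_top)
      refine lintegral_mono fun x => lintegral_mono fun f => ?_
      simp only [ENNReal.ofReal_one]
      split_ifs <;> simp
  · have hkn : ¬ (k : ℕ) ≤ n := fun h => hk <| Finset.mem_Icc.2 ⟨one_le, by
      rw [← PNat.coe_le_coe, Nat.succPNat_coe]
      exact h.trans (Nat.le_succ n)⟩
    simp [loopIntegral, hkn]

theorem tsum_inv_lt_le {y : ℝ} (hy : 1 ≤ y) :
    ∑' k : ℕ+, ENNReal.ofReal (if (k : ℝ) < y then (k : ℝ)⁻¹ else 0)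
      ≤ ENNReal.ofReal (1 + Real.log y) := by
  rw [tsum_pnat_eq_tsum_succ
      (f := fun k : ℕ => ENNReal.ofReal (if (k : ℝ) < y then (k : ℝ)⁻¹ else 0)),
    tsum_eq_sum (s := Finset.range ⌊y⌋₊) fun k hk => ?_]
  · rw [← ENNReal.ofReal_sum_of_nonneg fun k _ => by positivity]
    refine ENNReal.ofReal_le_ofReal (le_trans ?_ (harmonic_floor_le_one_add_log y hy))
    rw [harmonic, Rat.cast_sum]
    refine Finset.sum_le_sum fun k _ => ?_
    split_ifs
    · simp
    · positivity
  · have hlt : ¬ ((k + 1 : ℕ) : ℝ) < y := fun h => hk <| Finset.mem_range.2 <|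
      Nat.lt_of_succ_le (Nat.le_floor h.le)
    rw [if_neg hlt, ENNReal.ofReal_zero]

theorem summable_inv_mul_inv_sqrt : Summable fun k : ℕ+ => (k : ℝ)⁻¹ * (√(k : ℝ))⁻¹ := by
  have hrpow := (Real.summable_nat_rpow_inv (p := 3 / 2)).2 (by norm_num)
  refine (hrpow.comp_injective PNat.coe_injective).congr fun k => ?_
  have hk : (0 : ℝ) < k := by exact_mod_cast k.pos
  rw [Function.comp_apply, ← mul_inv, show (3 / 2 : ℝ) = 1 + 1 / 2 by norm_num,
    Real.rpow_add hk, Real.rpow_one, Real.sqrt_eq_rpow]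

end Soup

/-! ### Exponential Chebyshev bounds -/

section Chernoff

variable {d : ℕ} {β : ℝ≥0} {bc : BC} {a K : ℝ}

/-- On the torus, `k` particles have density at least `K`. For the other boundary conditions the
predicate is false: there the kernels decay in `k`, and no loop needs to be treated separately. -/
def IsDense (d : ℕ) (bc : BC) (a K : ℝ) (k : ℕ) : Prop :=
  bc = .per ∧ K * boxVolume d a ≤ k

open Classical in
/-- The function of single loops that is integrated in the exponential Chebyshev inequality: on the
loops that are too dense on the torus, superstability alone provides the decay `exp (-ℓ(f))`. -/
noncomputable def majorant (bc : BC) (a K : ℝ) (X : Path d β → ℝ≥0∞) (f : Path d β) : ℝ≥0∞ :=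
  if IsDense d bc a K f.1 then ENNReal.ofReal (Real.exp (-f.1)) else 1 + X f

theorem measurable_majorant {X : Path d β → ℝ≥0∞} (hX : Measurable X) :
    Measurable (majorant bc a K X) := by
  refine measurable_of_comp_sigmaMk fun k => ?_
  by_cases hk : IsDense d bc a K k
  · simp only [majorant, hk, if_true]
    exact measurable_const
  · simp only [majorant, hk, if_false]
    exact measurable_const.add (hX.comp (measurable_sigmaMk k))

theorem exp_sub_selfEnergy_le_of_isDense {v : Space d → ℝ} (hv : AssumptionV v) {C : ℝ}
    (hC0 : 0 < C) (hC : SuperstableOnCubes C v) (hβ : 0 < β) (ha : 1 ≤ a) (θ : ℝ) {f : Path d β}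
    (hf : IsDense d bc a (1 + (θ + 1) / (β * C)) f.1) :
    ENNReal.ofReal (Real.exp (θ * f.1 - selfEnergy (bcPotential bc a v) f))
      ≤ ENNReal.ofReal (Real.exp (-f.1)) := by
  obtain ⟨rfl, hf⟩ := hf
  have hβ' : (0 : ℝ) < β := hβ
  have hV : 0 < boxVolume d a := boxVolume_pos (by linarith)
  rw [← le_div_iff₀ hV] at hf
  have henergy : (θ + 1) * f.1 ≤ selfEnergy (bcPotential .per a v) f := by
    calc (θ + 1) * f.1 = β * (C * ((1 + (θ + 1) / (β * C) - 1) * f.1)) := by field_simp; ring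
      _ ≤ β * (C * ((f.1 / boxVolume d a - 1) * f.1)) := by gcongr
      _ = β * (C * ((f.1 : ℝ) ^ 2 / boxVolume d a - f.1)) := by ring
      _ ≤ _ := selfEnergy_per_ge hv hC ha f
  exact ENNReal.ofReal_le_ofReal (Real.exp_le_exp.2 (by linarith))

theorem exp_neg_le_inv_sqrt {k : ℕ} (hk : 1 ≤ k) : Real.exp (-k) ≤ (√(k : ℝ))⁻¹ := by
  have hk' : (1 : ℝ) ≤ k := by exact_mod_cast hk
  rw [Real.exp_neg]
  gcongr
  calc √(k : ℝ) ≤ k := Real.sqrt_le_self_iff.2 (.inr hk')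
    _ ≤ Real.exp k := by linarith [Real.add_one_le_exp (k : ℝ)]

theorem boxVolume_mul_windingDensity_le_one (ha : 0 < a) :
    boxVolume d a * windingDensity d bc a ≤ 1 := by
  cases bc
  · exact (mul_inv_cancel₀ (boxVolume_pos ha).ne').le
  all_goals simp [windingDensity]

theorem boxVolume_mul_windingDensity_le_ite (ha : 0 < a) {k : ℕ} (hk : ¬ IsDense d bc a K k) :
    boxVolume d a * windingDensity d bc a ≤ if k < K * boxVolume d a then 1 else 0 := by
  split_ifs with hlt
  · exact boxVolume_mul_windingDensity_le_one ha
  · cases bc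
    · exact absurd ⟨rfl, not_lt.1 hlt⟩ hk
    all_goals simp [windingDensity]

theorem one_le_boxVolume (ha : 1 ≤ a) : 1 ≤ boxVolume d a :=
  one_le_pow₀ (by linarith)

theorem loopIntegral_majorant_le (hd : 1 ≤ d) (hβ : 0 < β) {W : Measure C(ℝ≥0, Space d)}
    (hW : IsWienerMeasure W) (ha : 1 ≤ a) {k : ℕ} (hk : 1 ≤ k) {X : Path d β → ℝ≥0∞}
    (hX : loopIntegral W bc a k X ≤ ENNReal.ofReal (boxVolume d a * kernelBound d β bc a k)) :
    loopIntegral W bc a k (majorant bc a K X)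
      ≤ ENNReal.ofReal (2 * kernelConst d β
        * (boxVolume d a * (√(k : ℝ))⁻¹ + if k < K * boxVolume d a then 1 else 0)) := by
  have ha0 : 0 < a := by linarith
  have hc := kernelConst_nonneg (d := d) (β := β)
  have hV := one_le_boxVolume (d := d) ha
  have hVW := boxVolume_mul_windingDensity_le_one (d := d) (bc := bc) ha0
  by_cases hdense : IsDense d bc a K k
  · calc _ = loopIntegral (β := β) W bc a k fun _ => ENNReal.ofReal (Real.exp (-k)) := by
          simp only [loopIntegral, majorant, hdense, if_true]
      _ ≤ ENNReal.ofReal (boxVolume d a * (Real.exp (-k) * kernelBound d β bc a k)) :=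
          loopIntegral_const_le hd hβ hW bc ha0 hk (Real.exp_pos _).le
      _ ≤ _ := ENNReal.ofReal_le_ofReal ?_
    calc _ = kernelConst d β * (boxVolume d a * (Real.exp (-k) * (√(k : ℝ))⁻¹)
          + Real.exp (-k) * (boxVolume d a * windingDensity d bc a)) := by
          rw [kernelBound]; ring
      _ ≤ kernelConst d β * (boxVolume d a * (1 * (√(k : ℝ))⁻¹)
          + boxVolume d a * (√(k : ℝ))⁻¹ * 1) := by
          have := windingDensity_nonneg (d := d) (bc := bc) ha0
          gcongr
          · exact Real.exp_le_one_iff.2 (by simp)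
          · exact (exp_neg_le_inv_sqrt hk).trans (le_mul_of_one_le_left (by positivity) hV)
      _ = 2 * kernelConst d β * (boxVolume d a * (√(k : ℝ))⁻¹ + 0) := by ring
      _ ≤ _ := by gcongr; split_ifs <;> norm_num
  · calc _ = loopIntegral W bc a k fun f => 1 + X f := by
          simp only [loopIntegral, majorant, hdense, if_false]
      _ ≤ ENNReal.ofReal (boxVolume d a * kernelBound d β bc a k)
          + ENNReal.ofReal (boxVolume d a * kernelBound d β bc a k) :=
          (loopIntegral_one_add_le hd hβ hW bc ha0 hk X).trans (by gcongr)
      _ = ENNReal.ofReal (2 * kernelConst d β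
          * (boxVolume d a * (√(k : ℝ))⁻¹ + boxVolume d a * windingDensity d bc a)) := by
          have := kernelBound_nonneg (d := d) (β := β) (bc := bc) ha0 k
          rw [← ENNReal.ofReal_add (by positivity) (by positivity), kernelBound]
          congr 1; ring
      _ ≤ _ := by gcongr; exact boxVolume_mul_windingDensity_le_ite ha0 hdense

theorem tsum_inv_mul_le {c V : ℝ} (hc : 0 ≤ c) (hV : 1 ≤ V) (hK : 1 ≤ K) :
    ∑' k : ℕ+, (k : ℝ≥0∞)⁻¹
        * ENNReal.ofReal (c * (V * (√(k : ℝ))⁻¹ + if (k : ℝ) < K * V then 1 else 0))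
      ≤ ENNReal.ofReal (c * (∑' k : ℕ+, (k : ℝ)⁻¹ * (√(k : ℝ))⁻¹ + 1) * V
        + c * (1 + Real.log K)) := by
  have hlogKV := Real.log_nonneg (one_le_mul_of_one_le_of_one_le hK hV)
  have hlog : Real.log (K * V) ≤ Real.log K + V := by
    rw [Real.log_mul (by positivity) (by positivity)]
    linarith [Real.log_le_sub_one_of_pos (zero_lt_one.trans_le hV)]
  set S := ∑' k : ℕ+, (k : ℝ)⁻¹ * (√(k : ℝ))⁻¹
  have : 0 ≤ S := tsum_nonneg fun _ => by positivity
  calc _ = ∑' k : ℕ+, (ENNReal.ofReal (c * V * ((k : ℝ)⁻¹ * (√(k : ℝ))⁻¹))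
        + ENNReal.ofReal c * ENNReal.ofReal (if (k : ℝ) < K * V then (k : ℝ)⁻¹ else 0)) := by
        refine tsum_congr fun k => ?_
        have hk : (0 : ℝ) < k := by exact_mod_cast k.pos
        rw [← ENNReal.ofReal_natCast, ← ENNReal.ofReal_inv_of_pos hk,
          ← ENNReal.ofReal_mul (by positivity), ← ENNReal.ofReal_mul (by positivity),
          ← ENNReal.ofReal_add (by positivity) (by positivity)]
        congr 1
        split_ifs <;> ring
    _ ≤ ENNReal.ofReal (c * V * S) + ENNReal.ofReal c * ENNReal.ofReal (1 + Real.log (K * V)) := by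
        rw [ENNReal.tsum_add, ENNReal.tsum_mul_left, ← tsum_mul_left,
          ← ENNReal.ofReal_tsum_of_nonneg (fun _ => by positivity)
            (summable_inv_mul_inv_sqrt.mul_left _)]
        gcongr
        exact tsum_inv_lt_le (one_le_mul_of_one_le_of_one_le hK hV)
    _ ≤ _ := by
        rw [← ENNReal.ofReal_mul (by positivity),
          ← ENNReal.ofReal_add (by positivity) (by positivity)]
        refine ENNReal.ofReal_le_ofReal ?_
        calc _ ≤ c * V * S + c * (1 + (Real.log K + V)) := by gcongr
          _ = _ := by ring

theorem lintegral_majorant_le (hd : 1 ≤ d) (hβ : 0 < β) {W : Measure C(ℝ≥0, Space d)}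
    (hW : IsWienerMeasure W) (ha : 1 ≤ a) (hK : 1 ≤ K) {X : Path d β → ℝ≥0∞}
    (hX : ∀ k : ℕ, 1 ≤ k →
      loopIntegral W bc a k X ≤ ENNReal.ofReal (boxVolume d a * kernelBound d β bc a k)) :
    ∫⁻ z, majorant bc a K X z.2 ∂intensity W β bc a
      ≤ ENNReal.ofReal (2 * kernelConst d β * (∑' k : ℕ+, (k : ℝ)⁻¹ * (√(k : ℝ))⁻¹ + 1)
        * boxVolume d a + 2 * kernelConst d β * (1 + Real.log K)) := by
  refine (lintegral_intensity_le W bc a _).trans (le_trans ?_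
    (tsum_inv_mul_le (mul_nonneg zero_le_two kernelConst_nonneg) (one_le_boxVolume ha) hK))
  gcongr with k
  exact loopIntegral_majorant_le hd hβ hW ha k.pos (hX k k.pos)

theorem exp_sub_selfEnergy_le_majorant {v : Space d → ℝ} (hv : AssumptionV v) {C : ℝ}
    (hC0 : 0 < C) (hC : SuperstableOnCubes C v) (hβ : 0 < β) (ha : 1 ≤ a) {θ : ℝ} (hθ : 0 ≤ θ)
    {P : Path d β → Prop} [DecidablePred P] {X : Path d β → ℝ≥0∞}
    (hP : ∀ f, P f →
      ENNReal.ofReal (Real.exp (θ * f.1 - selfEnergy (bcPotential bc a v) f)) ≤ 1 + X f)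
    (f : Path d β) :
    ENNReal.ofReal (Real.exp (θ * (if P f then f.1 else 0 : ℕ)
      - selfEnergy (bcPotential bc a v) f))
      ≤ majorant bc a (1 + (θ + 1) / (β * C)) X f := by
  unfold majorant
  split_ifs with hf hdense hdense
  · exact exp_sub_selfEnergy_le_of_isDense hv hC0 hC hβ ha θ hdense
  · exact hP f hf
  · refine le_trans ?_ (exp_sub_selfEnergy_le_of_isDense hv hC0 hC hβ ha θ hdense)
    gcongr
    exact Nat.zero_le _
  · have := selfEnergy_nonneg (bcPotential_nonneg hv bc a) f
    refine le_trans ?_ le_self_add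
    rw [ENNReal.ofReal_le_one, Real.exp_le_one_iff]
    simpa

-- It is essential that `C₁` does not depend on `θ`: the exponent `-θ ε |Λ|` can then win.
theorem exists_transformedLaw_le (hd : 1 ≤ d) (hβ : 0 < β) {W : Measure C(ℝ≥0, Space d)}
    (hW : IsWienerMeasure W) {v : Space d → ℝ} (hv : AssumptionV v) :
    ∃ C₁ : ℝ, ∀ θ : ℝ, 0 ≤ θ → ∃ C₂ : ℝ, ∀ (bc : BC) (a : ℝ), 1 ≤ a →
      ∀ (P : Path d β → Prop) [DecidablePred P] (X : Path d β → ℝ≥0∞), Measurable X →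
      (∀ f, P f →
        ENNReal.ofReal (Real.exp (θ * f.1 - selfEnergy (bcPotential bc a v) f)) ≤ 1 + X f) →
      (∀ k : ℕ, 1 ≤ k →
        loopIntegral W bc a k X ≤ ENNReal.ofReal (boxVolume d a * kernelBound d β bc a k)) →
      ∀ c : ℝ, transformedLaw W β v bc a
          {ω | c < ((∑ p, if P (ω.2 p).2 then (ω.2 p).2.1 else 0 : ℕ) : ℝ)}
        ≤ ENNReal.ofReal (Real.exp (-(θ * c) + (C₁ * boxVolume d a + C₂))) := by
  obtain ⟨C, hC0, hC⟩ := hv.exists_superstableOnCubes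
  refine ⟨2 * kernelConst d β * (∑' k : ℕ+, (k : ℝ)⁻¹ * (√(k : ℝ))⁻¹ + 1), fun θ hθ =>
    ⟨2 * kernelConst d β * (1 + Real.log (1 + (θ + 1) / (β * C))),
      fun bc a ha P _ X hX hP hint c => ?_⟩⟩
  have : (0 : ℝ) < β := hβ
  have ha0 : 0 < a := by linarith
  have hc := kernelConst_nonneg (d := d) (β := β)
  have hV := boxVolume_pos (d := d) ha0
  have hK : 1 ≤ 1 + (θ + 1) / (β * C) := le_add_of_nonneg_right (by positivity)
  have hlog := Real.log_nonneg hK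
  have : 0 ≤ ∑' k : ℕ+, (k : ℝ)⁻¹ * (√(k : ℝ))⁻¹ := tsum_nonneg fun _ => by positivity
  have := sigmaFinite_intensity (β := β) hd hβ hW bc ha0
  refine tilted_poissonWeight_le (intensity W β bc a) (H := boltzmann (bcPotential bc a v))
    (h := fun z => majorant bc a (1 + (θ + 1) / (β * C)) X z.2)
    (fun z => ?_) (fun z => if P z.2 then z.2.1 else 0)
    (fun z => selfEnergy (bcPotential bc a v) z.2) (fun ω => ?_) hθ
    ((measurable_majorant hX).comp measurable_snd)
    (fun z => exp_sub_selfEnergy_le_majorant hv hC0 hC hβ ha hθ hP z.2) (by positivity)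
    (lintegral_majorant_le hd hβ hW ha hK hint) c
  · simp [boltzmann, interaction]
  · refine ENNReal.ofReal_le_ofReal (Real.exp_le_exp.2 (neg_le_neg ?_))
    exact sum_selfEnergy_le_interaction (continuous_bcPotential hv bc ha0)
      (bcPotential_nonneg hv bc a) ω

end Chernoff

/-! ### Long noncrossing loops -/

section NonCrossing

variable {d : ℕ} {β : ℝ≥0}

instance sFinite_bridgeMeasure (W : Measure C(ℝ≥0, Space d)) [IsProbabilityMeasure W] (k : ℕ)
    (x y : Space d) : SFinite (bridgeMeasure W β k x y) := by
  unfold bridgeMeasure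
  infer_instance

theorem measurable_exp_displacement_mk_uncurry (k : ℕ) :
    Measurable fun p : ℝ × PathSpace d β k =>
      ENNReal.ofReal (Real.exp (displacement p.1 ⟨k, p.2⟩)) := by
  have hmk : Measurable fun p : ℝ × PathSpace d β k => (p.1, (⟨k, p.2⟩ : Path d β)) :=
    measurable_fst.prodMk ((measurable_sigmaMk k).comp measurable_snd)
  exact (Real.measurable_exp.comp (measurable_displacement_uncurry.comp hmk)).ennreal_ofReal

theorem measurable_meanExpDisplacement_mk (k : ℕ) :
    Measurable fun f : PathSpace d β k => meanExpDisplacement ⟨k, f⟩ := by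
  simp only [meanExpDisplacement, setLAverage_eq]
  exact (measurable_exp_displacement_mk_uncurry k).lintegral_prod_left'.div_const _

theorem lintegral_meanExpDisplacement_le (hd : 1 ≤ d) {W : Measure C(ℝ≥0, Space d)}
    (hW : IsWienerMeasure W) (hβ : 0 < β) {k : ℕ} (hk : 1 ≤ k) (x y : Space d) :
    ∫⁻ f, meanExpDisplacement ⟨k, f⟩ ∂bridgeMeasure W β k x y
      ≤ ENNReal.ofReal (displacementRate d β ^ k * widenedHeatKernel (k * β) x y) := by
  have := hW.isProbabilityMeasure hd
  have hm := measurable_exp_displacement_mk_uncurry (d := d) (β := β) k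
  simp only [meanExpDisplacement, setLAverage_eq, div_eq_mul_inv]
  rw [lintegral_mul_const _ hm.lintegral_prod_left', lintegral_lintegral_swap
    (f := fun (f : PathSpace d β k) (s : ℝ) => ENNReal.ofReal (Real.exp (displacement s ⟨k, f⟩)))
    (hm.comp measurable_swap).aemeasurable, ← div_eq_mul_inv]
  refine ENNReal.div_le_of_le_mul ?_
  calc _ ≤ ∫⁻ _ in Set.Ioc (0 : ℝ) β,
        ENNReal.ofReal (displacementRate d β ^ k * widenedHeatKernel (k * β) x y) :=
        setLIntegral_mono measurable_const fun s hs =>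
          lintegral_exp_displacement_le hd hW hβ hk hs.1.le hs.2 x y
    _ = _ := setLIntegral_const _ _

theorem loopIntegral_le_of_forall (hd : 1 ≤ d) (hβ : 0 < β) (W : Measure C(ℝ≥0, Space d))
    (bc : BC) {a : ℝ} (ha : 0 < a) {k : ℕ} (hk : 1 ≤ k) {X : Path d β → ℝ≥0∞}
    (hX : ∀ x y, ∫⁻ f, X ⟨k, f⟩ ∂bridgeMeasure W β k x y
      ≤ ENNReal.ofReal (widenedHeatKernel (k * β) x y)) :
    loopIntegral W bc a k X ≤ ENNReal.ofReal (boxVolume d a * kernelBound d β bc a k) := by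
  calc _ ≤ ∫⁻ _ in cube (0 : Space d) a, ENNReal.ofReal (1 * kernelBound d β bc a k) :=
        lintegral_mono fun x => lintegral_bcBridgeMeasure_le hd hβ W bc ha hk x zero_le_one
          fun y => by simpa only [one_mul] using hX x y
    _ = _ := by
        rw [setLIntegral_const, volume_cube _ ha.le, one_mul, mul_comm,
          ENNReal.ofReal_mul (boxVolume_pos ha).le]

theorem loopIntegral_exp_mul_meanExpDisplacement_le (hd : 1 ≤ d) (hβ : 0 < β)
    {W : Measure C(ℝ≥0, Space d)} (hW : IsWienerMeasure W) (bc : BC) {a : ℝ} (ha : 0 < a) {k : ℕ}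
    (hk : 1 ≤ k) {t : ℝ} (ht : t + Real.log (displacementRate d β) ≤ 0) :
    loopIntegral (β := β) W bc a k
        (fun f => ENNReal.ofReal (Real.exp (t * f.1)) * meanExpDisplacement f)
      ≤ ENNReal.ofReal (boxVolume d a * kernelBound d β bc a k) := by
  have hrate := displacementRate_pos (d := d) (β := β)
  have hle : Real.exp (t * k) * displacementRate d β ^ k ≤ 1 := by
    rw [← Real.exp_log hrate, ← Real.exp_nat_mul, ← Real.exp_add, Real.exp_le_one_iff, mul_comm t,
      ← mul_add]
    exact mul_nonpos_of_nonneg_of_nonpos k.cast_nonneg ht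
  refine loopIntegral_le_of_forall hd hβ W bc ha hk fun x y => ?_
  have hkernel : 0 ≤ widenedHeatKernel (k * β) x y := by unfold widenedHeatKernel; positivity
  dsimp only
  rw [lintegral_const_mul _ (measurable_meanExpDisplacement_mk k)]
  calc _ ≤ ENNReal.ofReal (Real.exp (t * k))
        * ENNReal.ofReal (displacementRate d β ^ k * widenedHeatKernel (k * β) x y) := by
        gcongr
        exact lintegral_meanExpDisplacement_le hd hW hβ hk x y
    _ = ENNReal.ofReal
        (Real.exp (t * k) * displacementRate d β ^ k * widenedHeatKernel (k * β) x y) := by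
        rw [← ENNReal.ofReal_mul (Real.exp_pos _).le, mul_assoc]
    _ ≤ _ := ENNReal.ofReal_le_ofReal (mul_le_of_le_one_left hkernel hle)

theorem exists_particlesNonCrossingGt_le (hd : 1 ≤ d) (hβ : 0 < β) {W : Measure C(ℝ≥0, Space d)}
    (hW : IsWienerMeasure W) {v : Space d → ℝ} (hv : AssumptionV v) :
    ∃ C₁ : ℝ, ∀ R : ℕ, ∃ (L : ℕ) (C₂ : ℝ), R ≤ L ∧ ∀ (bc : BC) (a r : ℝ), 1 ≤ a → 0 ≤ r →
      r ≤ R + 1 → ∀ c : ℝ,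
      transformedLaw W β v bc a {ω | c < (particlesNonCrossingGt bc a r L ω : ℝ)}
        ≤ ENNReal.ofReal (Real.exp (-(R * c) + (C₁ * boxVolume d a + C₂))) := by
  classical
  obtain ⟨C, hC0, hC⟩ := hv.exists_superstableOnCubes
  obtain ⟨C₁, hmain⟩ := exists_transformedLaw_le hd hβ hW hv
  refine ⟨C₁, fun R => ?_⟩
  obtain ⟨C₂, hmain⟩ := hmain R R.cast_nonneg
  have : (0 : ℝ) < β := hβ
  have hlog : 0 ≤ Real.log (displacementRate d β) := Real.log_nonneg one_le_displacementRate
  set D : ℝ := 4 * (R + Real.log (displacementRate d β)) + 1 with hD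
  have hD1 : 1 ≤ D := le_add_of_nonneg_left (by positivity)
  set B : ℝ := (2 * (R + 1 + D)) ^ d
  have hB : 0 < B := by positivity
  set L : ℕ := max R ⌈2 * B * (R / (β * C) + 1)⌉₊
  refine ⟨L, C₂, le_max_left _ _, fun bc a r ha hr hrR c => ?_⟩
  have ha0 : 0 < a := by linarith
  refine hmain bc a ha (fun f => NonCrossing bc a r f ∧ L < f.1)
    (fun f => ENNReal.ofReal (Real.exp ((R - D / 4) * f.1)) * meanExpDisplacement f)
    (measurable_of_comp_sigmaMk fun k => (measurable_meanExpDisplacement_mk k).const_mul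
      (ENNReal.ofReal (Real.exp ((R - D / 4) * k))))
    (fun f hf => ?_) (fun k hk => loopIntegral_exp_mul_meanExpDisplacement_le hd hβ hW bc ha0 hk
      (by rw [hD]; linarith)) c
  refine exp_sub_selfEnergy_nonCrossing_le hv hC0.le hC bc ha0 hβ hr hD1 hf.1 ?_
  have hlong : 2 * B * (R / (β * C) + 1) ≤ f.1 :=
    (Nat.le_ceil _).trans (by exact_mod_cast (le_max_right _ _).trans hf.2.le)
  calc (R : ℝ) = β * (C * (1 / 2 * (2 * B * (R / (β * C) + 1)) / B - 1)) := by field_simp; ring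
    _ ≤ β * (C * (1 / 2 * (f.1 : ℝ) / (2 * (r + D)) ^ d - 1)) := by
        gcongr
        exact pow_le_pow_left₀ (by positivity) (by gcongr) d

end NonCrossing

/-! ### Short crossing loops -/

section Crossing

variable {d : ℕ} {β : ℝ≥0}

theorem abs_eval_sub_le_displacement (f : Path d β) {l : ℕ} (hl : l < f.1) (c : Fin d) :
    |f.eval (l * β) c - f.eval 0 c| ≤ displacement β f := by
  have htelescope := Finset.sum_range_sub (fun i : ℕ => f.eval (i * β) c) l
  simp only [Nat.cast_zero, zero_mul] at htelescope
  rw [← htelescope]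
  calc _ ≤ ∑ i ∈ Finset.range l, |f.eval ((i + 1 : ℕ) * β) c - f.eval (i * β) c| :=
        Finset.abs_sum_le_sum_abs _ _
    _ ≤ ∑ i ∈ Finset.range f.1, |f.eval ((i + 1 : ℕ) * β) c - f.eval (i * β) c| :=
        Finset.sum_le_sum_of_subset_of_nonneg (Finset.range_subset_range.2 hl.le)
          fun _ _ _ => abs_nonneg _
    _ ≤ _ := by
        refine Finset.sum_le_sum fun i _ => ?_
        rw [Nat.cast_succ, add_one_mul]
        exact Finset.single_le_sum (f := fun c => |f.eval (i * β + β) c - f.eval (i * β) c|)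
          (fun c _ => abs_nonneg _) (Finset.mem_univ c)

theorem position_eq_self (bc : BC) {a : ℝ} {y : Space d} (hy : ∀ i, |y i| < a) :
    position bc a y = y := by
  cases bc with
  | per =>
    ext i
    have hfloor : ⌊(y i + a) / (2 * a)⌋ = 0 := by
      obtain ⟨hlower, hupper⟩ := abs_lt.1 (hy i)
      have h2a : 0 < 2 * a := by linarith
      exact Int.floor_eq_zero_iff.2
        ⟨div_nonneg (by linarith) h2a.le, (div_lt_one h2a).2 (by linarith)⟩
    simp [position, hfloor]
  | zero => rfl
  | par => rfl

theorem abs_add_le_of_cube_subset {c : Space d} {r a : ℝ} (hr : 0 ≤ r)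
    (h : cube c r ⊆ cube 0 a) (i : Fin d) : |c i| + r ≤ a := by
  have hcorner (s : ℝ) (hs : |s| = r) : |c i + s| ≤ a := by
    have hmem : WithLp.toLp 2 (fun j => c j + s) ∈ cube c r := fun j => by simp [hs]
    simpa using h hmem i
  have hplus := le_of_abs_le (hcorner r (abs_of_nonneg hr))
  have hminus := neg_le_of_abs_le (hcorner (-r) (by rw [abs_neg, abs_of_nonneg hr]))
  rcases abs_cases (c i) with ⟨hc, -⟩ | ⟨hc, -⟩ <;> rw [hc] <;> linarith

/-- The points at distance at least `D` from the faces of the subboxes `2 r n + [-r, r]^d` with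
`n ∈ Z` in which they lie. -/
def deepPoints (Z : Set (Fin d → ℤ)) (r D : ℝ) : Set (Space d) :=
  ⋃ n ∈ Z, cube (latticePoint (2 * r) n) (r - D)

theorem nonCrossing_of_eval_zero_mem_deepPoints (bc : BC) {a r D : ℝ} (hr : 0 ≤ r)
    {Z : Set (Fin d → ℤ)} (hZ : ∀ n ∈ Z, cube (latticePoint (2 * r) n) r ⊆ cube (0 : Space d) a)
    {f : Path d β} (hstart : f.eval 0 ∈ deepPoints Z r D) (hf : displacement β f < D) :
    NonCrossing bc a r f := by
  obtain ⟨n, hn, hstart⟩ := Set.mem_iUnion₂.1 hstart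
  refine ⟨n, fun l hl => ?_⟩
  have hnear (i : Fin d) :
      |f.eval (l * β) i - latticePoint (2 * r) n i| < r := by
    calc _ ≤ |f.eval (l * β) i - f.eval 0 i| + |f.eval 0 i - latticePoint (2 * r) n i| :=
          abs_sub_le _ _ _
      _ < r := by linarith [abs_eval_sub_le_displacement f hl i, hstart i]
  rw [position_eq_self bc fun i => ?_]
  · exact fun i => (hnear i).le
  · linarith [hnear i, abs_sub_abs_le_abs_sub (f.eval (l * β) i) (latticePoint (2 * r) n i),
      abs_add_le_of_cube_subset hr (hZ n hn) i]

theorem pairwise_disjoint_ball_latticePoint (r : ℝ) :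
    Pairwise fun n m : Fin d → ℤ => Disjoint
      (Metric.ball (WithLp.ofLp (latticePoint (2 * r) n)) r)
      (Metric.ball (WithLp.ofLp (latticePoint (2 * r) m)) r) := by
  intro n m hnm
  obtain ⟨i, hi⟩ := Function.ne_iff.1 hnm
  have hone : (1 : ℝ) ≤ |(n i : ℝ) - m i| := by
    exact_mod_cast Int.one_le_abs (sub_ne_zero.2 hi)
  refine Metric.ball_disjoint_ball ?_
  calc r + r ≤ |2 * r| * |(n i : ℝ) - m i| := by
        nlinarith [le_abs_self (2 * r), abs_nonneg (2 * r)]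
    _ = dist (latticePoint (2 * r) n i) (latticePoint (2 * r) m i) := by
        rw [Real.dist_eq, ← abs_mul, mul_sub]
        rfl
    _ ≤ _ := dist_le_pi_dist _ _ i

theorem tsum_boxVolume_le {a r : ℝ} (ha : 0 ≤ a) (hr : 0 < r) {Z : Set (Fin d → ℤ)}
    (hZ : ∀ n ∈ Z, cube (latticePoint (2 * r) n) r ⊆ cube (0 : Space d) a) :
    ∑' _ : Z, ENNReal.ofReal (boxVolume d r) ≤ ENNReal.ofReal (boxVolume d a) := by
  let interiorBox (n : Fin d → ℤ) : Set (Space d) :=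
    WithLp.ofLp ⁻¹' Metric.ball (WithLp.ofLp (latticePoint (2 * r) n)) r
  have hvol (n : Fin d → ℤ) : volume (interiorBox n) = ENNReal.ofReal (boxVolume d r) := by
    rw [(PiLp.volume_preserving_ofLp (Fin d)).measure_preimage
      Metric.isOpen_ball.measurableSet.nullMeasurableSet, Real.volume_pi_ball _ hr,
      Fintype.card_fin, boxVolume]
  calc _ = ∑' n : Z, volume (interiorBox n) := by simp only [hvol]
    _ = volume (⋃ n : Z, interiorBox n) :=
        (measure_iUnion (fun n m hnm => (pairwise_disjoint_ball_latticePoint r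
            (Subtype.coe_ne_coe.2 hnm)).preimage _)
          fun n => WithLp.measurable_ofLp 2 _ Metric.isOpen_ball.measurableSet).symm
    _ ≤ volume (cube (0 : Space d) a) := by
        refine measure_mono (Set.iUnion_subset fun n => .trans ?_ (hZ n n.2))
        rw [cube_eq_preimage_closedBall _ hr.le]
        exact Set.preimage_mono Metric.ball_subset_closedBall
    _ = _ := volume_cube _ ha

theorem boxVolume_sub_boxVolume_le {r D : ℝ} (hr : 0 < r) (hDr : D ≤ r) :
    boxVolume d r - boxVolume d (r - D) ≤ d * D / r * boxVolume d r := by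
  have hbernoulli : 1 + d * -(D / r) ≤ (1 + -(D / r)) ^ d :=
    one_add_mul_le_pow (by linarith [(div_le_one hr).2 hDr]) d
  have hscale : boxVolume d (r - D) = boxVolume d r * (1 + -(D / r)) ^ d := by
    rw [boxVolume, boxVolume, ← mul_pow]
    congr 1
    field_simp
    ring
  rw [hscale]
  linear_combination mul_le_mul_of_nonneg_left hbernoulli (boxVolume_pos (d := d) hr).le

theorem measurableSet_cube (c : Space d) (r : ℝ) : MeasurableSet (cube c r) := by
  unfold cube
  measurability

theorem volume_cube_diff_cube_le (c : Space d) {r D : ℝ} (hr : 0 < r) (hD : 0 ≤ D)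
    (hDr : D ≤ r) :
    volume (cube c r \ cube c (r - D))
      ≤ ENNReal.ofReal (d * D / r) * ENNReal.ofReal (boxVolume d r) := by
  have hrD : 0 ≤ r - D := sub_nonneg.2 hDr
  have hsub : cube c (r - D) ⊆ cube c r := fun y hy i => (hy i).trans (sub_le_self r hD)
  rw [measure_sdiff hsub
    (measurableSet_cube c _).nullMeasurableSet
    (by rw [volume_cube _ hrD]; exact ENNReal.ofReal_ne_top),
    volume_cube _ hr.le, volume_cube _ hrD,
    ← ENNReal.ofReal_sub _ (by unfold boxVolume; positivity), ← ENNReal.ofReal_mul (by positivity)]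
  exact ENNReal.ofReal_le_ofReal (boxVolume_sub_boxVolume_le hr hDr)

theorem volume_diff_deepPoints_le {a r D : ℝ} (ha : 0 ≤ a) (hr : 0 < r) (hD : 0 ≤ D) (hDr : D ≤ r)
    {Z : Set (Fin d → ℤ)}
    (hZ : cube (0 : Space d) a = ⋃ n ∈ Z, cube (latticePoint (2 * r) n) r) :
    volume (cube (0 : Space d) a \ deepPoints Z r D)
      ≤ ENNReal.ofReal (d * D / r * boxVolume d a) := by
  have hcover : cube (0 : Space d) a \ deepPoints Z r D ⊆ ⋃ n : Z,
      cube (latticePoint (2 * r) n) r \ cube (latticePoint (2 * r) n) (r - D) := by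
    intro y hy
    obtain ⟨n, hn, hyn⟩ := Set.mem_iUnion₂.1 (hZ ▸ hy.1)
    exact Set.mem_iUnion.2 ⟨⟨n, hn⟩, hyn, fun h => hy.2 (Set.mem_iUnion₂.2 ⟨n, hn, h⟩)⟩
  calc _ ≤ ∑' n : Z, volume (cube (latticePoint (2 * r) (n : Fin d → ℤ)) r
        \ cube (latticePoint (2 * r) (n : Fin d → ℤ)) (r - D)) :=
        (measure_mono hcover).trans (measure_iUnion_le _)
    _ ≤ ∑' _ : Z, ENNReal.ofReal (d * D / r) * ENNReal.ofReal (boxVolume d r) :=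
        ENNReal.tsum_le_tsum fun n => volume_cube_diff_cube_le _ hr hD hDr
    _ ≤ ENNReal.ofReal (d * D / r) * ENNReal.ofReal (boxVolume d a) := by
        rw [ENNReal.tsum_mul_left]
        gcongr
        exact tsum_boxVolume_le ha hr fun n hn => hZ ▸ Set.subset_biUnion_of_mem
          (u := fun n => cube (latticePoint (2 * r) n) r) hn
    _ = _ := (ENNReal.ofReal_mul (by positivity)).symm

theorem measurableSet_deepPoints (Z : Set (Fin d → ℤ)) (r D : ℝ) :
    MeasurableSet (deepPoints Z r D) :=
  MeasurableSet.biUnion Z.to_countable fun _ _ => measurableSet_cube _ _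

/-- A majorant of the indicator of the crossing loops: such a loop starts close to a face of a
subbox, or it has displacement at least `D`. -/
noncomputable def crossingMajorant (Z : Set (Fin d → ℤ)) (r D : ℝ) (f : Path d β) : ℝ≥0∞ :=
  (deepPoints Z r D)ᶜ.indicator 1 (f.eval 0) + ENNReal.ofReal (Real.exp (displacement β f - D))

theorem one_le_crossingMajorant {bc : BC} {a r : ℝ} (D : ℝ) (hr : 0 ≤ r) {Z : Set (Fin d → ℤ)}
    (hZ : ∀ n ∈ Z, cube (latticePoint (2 * r) n) r ⊆ cube (0 : Space d) a) {f : Path d β}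
    (hf : ¬ NonCrossing bc a r f) : 1 ≤ crossingMajorant Z r D f := by
  by_cases hstart : f.eval 0 ∈ deepPoints Z r D
  · have hD : D ≤ displacement β f := not_lt.1 fun hlt =>
      hf (nonCrossing_of_eval_zero_mem_deepPoints bc hr hZ hstart hlt)
    refine le_add_left (ENNReal.one_le_ofReal.2 (Real.one_le_exp (sub_nonneg.2 hD)))
  · refine le_add_right ?_
    rw [Set.indicator_of_mem (Set.mem_compl hstart), Pi.one_apply]

theorem measurable_indicator_eval_zero {G : Set (Space d)} (hG : MeasurableSet G) (k : ℕ) :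
    Measurable fun f : PathSpace d β k => (G.indicator 1 (Path.eval ⟨k, f⟩ 0) : ℝ≥0∞) :=
  (measurable_one.indicator hG).comp (measurable_eval k 0)

theorem measurable_crossingMajorant (Z : Set (Fin d → ℤ)) (r D : ℝ) :
    Measurable (crossingMajorant (β := β) Z r D) :=
  measurable_of_comp_sigmaMk fun k =>
    (measurable_indicator_eval_zero (measurableSet_deepPoints Z r D).compl k).add
      (Real.measurable_exp.comp
        (((measurable_displacement β).sub_const D).comp (measurable_sigmaMk k))).ennreal_ofReal

theorem lintegral_crossingMajorant_le (hd : 1 ≤ d) {W : Measure C(ℝ≥0, Space d)}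
    (hW : IsWienerMeasure W) (hβ : 0 < β) {k : ℕ} (hk : 1 ≤ k) (Z : Set (Fin d → ℤ)) (r D : ℝ)
    (x y : Space d) :
    ∫⁻ f, crossingMajorant Z r D ⟨k, f⟩ ∂bridgeMeasure W β k x y
      ≤ ENNReal.ofReal (((deepPoints Z r D)ᶜ.indicator 1 x
          + Real.exp (-D) * displacementRate d β ^ k) * widenedHeatKernel (k * β) x y) := by
  have hG := (measurableSet_deepPoints Z r D).compl
  set G := (deepPoints Z r D)ᶜ with hGdef
  have hkernel : 0 ≤ widenedHeatKernel (k * β) x y := by unfold widenedHeatKernel; positivity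
  have hrate := displacementRate_pos (d := d) (β := β)
  have hindicator : (G.indicator 1 x : ℝ≥0∞) = ENNReal.ofReal (G.indicator 1 x) := by
    by_cases hx : x ∈ G <;> simp [hx]
  simp only [crossingMajorant, ← hGdef, Real.exp_sub, div_eq_inv_mul, ← Real.exp_neg]
  simp only [ENNReal.ofReal_mul (Real.exp_pos _).le]
  rw [lintegral_add_left (measurable_indicator_eval_zero hG k),
    lintegral_const_mul' _ _ ENNReal.ofReal_ne_top]
  calc _ ≤ G.indicator 1 x * ENNReal.ofReal (widenedHeatKernel (k * β) x y)
        + ENNReal.ofReal (Real.exp (-D))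
          * ENNReal.ofReal (displacementRate d β ^ k * widenedHeatKernel (k * β) x y) := by
        gcongr
        · exact lintegral_eval_zero_le hd hW k x y (measurable_one.indicator hG)
        · exact lintegral_exp_displacement_le hd hW hβ hk β.2 le_rfl x y
    _ = _ := by
        have hnonneg : (0 : ℝ) ≤ G.indicator 1 x := Set.indicator_nonneg (fun _ _ => zero_le_one) x
        rw [hindicator, ← ENNReal.ofReal_mul hnonneg, ← ENNReal.ofReal_mul (Real.exp_pos _).le,
          ← ENNReal.ofReal_add (by positivity) (by positivity), add_mul, mul_assoc]

theorem loopIntegral_crossingMajorant_le (hd : 1 ≤ d) (hβ : 0 < β) {W : Measure C(ℝ≥0, Space d)}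
    (hW : IsWienerMeasure W) (bc : BC) {a r D : ℝ} (ha : 0 < a) (hr : 0 < r) (hD : 0 ≤ D)
    (hDr : D ≤ r) {Z : Set (Fin d → ℤ)}
    (hZ : cube (0 : Space d) a = ⋃ n ∈ Z, cube (latticePoint (2 * r) n) r) {k : ℕ} (hk : 1 ≤ k) :
    loopIntegral (β := β) W bc a k (crossingMajorant Z r D)
      ≤ ENNReal.ofReal ((d * D / r + Real.exp (-D) * displacementRate d β ^ k)
        * (boxVolume d a * kernelBound d β bc a k)) := by
  have hG := (measurableSet_deepPoints Z r D).compl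
  set G := (deepPoints Z r D)ᶜ with hGdef
  have hrate := displacementRate_pos (d := d) (β := β)
  have hV := (boxVolume_pos (d := d) ha).le
  have hkernel := kernelBound_nonneg (d := d) (β := β) (bc := bc) ha k
  set J := kernelBound d β bc a k
  set t := Real.exp (-D) * displacementRate d β ^ k
  have ht : 0 ≤ t := by positivity
  have hnonneg (x : Space d) : (0 : ℝ) ≤ G.indicator 1 x :=
    Set.indicator_nonneg (fun _ _ => zero_le_one) x
  have hindicator (x : Space d) : ENNReal.ofReal (G.indicator 1 x) = G.indicator 1 x := by
    by_cases hx : x ∈ G <;> simp [hx]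
  have hshell : volume.restrict (cube (0 : Space d) a) G
      ≤ ENNReal.ofReal (d * D / r * boxVolume d a) := by
    rw [Measure.restrict_apply hG, Set.inter_comm, hGdef, ← Set.sdiff_eq]
    exact volume_diff_deepPoints_le ha.le hr hD hDr hZ
  calc _ ≤ ∫⁻ x in cube (0 : Space d) a, ENNReal.ofReal ((G.indicator 1 x + t) * J) :=
        lintegral_mono fun x => lintegral_bcBridgeMeasure_le hd hβ W bc ha hk x
          (add_nonneg (hnonneg x) ht) fun y => lintegral_crossingMajorant_le hd hW hβ hk Z r D x y
    _ = (volume.restrict (cube (0 : Space d) a) G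
        + ENNReal.ofReal t * ENNReal.ofReal (boxVolume d a)) * ENNReal.ofReal J := by
        simp only [ENNReal.ofReal_mul' hkernel, ENNReal.ofReal_add (hnonneg _) ht, hindicator]
        rw [lintegral_mul_const' _ _ ENNReal.ofReal_ne_top, lintegral_add_right _ measurable_const,
          lintegral_indicator_one hG, setLIntegral_const, volume_cube _ ha.le]
    _ ≤ _ := by
        rw [← ENNReal.ofReal_mul ht, ← mul_assoc, ENNReal.ofReal_mul' hkernel,
          add_mul (d * D / r), ENNReal.ofReal_add (by positivity) (by positivity)]
        gcongr

theorem loopIntegral_const_mul (W : Measure C(ℝ≥0, Space d)) (bc : BC) (a : ℝ) (k : ℕ)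
    {b : ℝ≥0∞} (hb : b ≠ ∞) (F : Path d β → ℝ≥0∞) :
    loopIntegral W bc a k (fun f => b * F f) = b * loopIntegral W bc a k F := by
  simp only [loopIntegral, lintegral_const_mul' _ _ hb]

theorem loopIntegral_crossingMajorant_le_of_le (hd : 1 ≤ d) (hβ : 0 < β)
    {W : Measure C(ℝ≥0, Space d)} (hW : IsWienerMeasure W) (bc : BC) {a r D : ℝ} (ha : 0 < a)
    (hr : 0 < r) (hD : 0 ≤ D) (hDr : D ≤ r) {Z : Set (Fin d → ℤ)}
    (hZ : cube (0 : Space d) a = ⋃ n ∈ Z, cube (latticePoint (2 * r) n) r) {b : ℝ} {L : ℕ}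
    (hb : 0 ≤ b) (hsmall : b * (d * D / r + Real.exp (-D) * displacementRate d β ^ L) ≤ 1)
    {k : ℕ} (hk : 1 ≤ k) (hkL : k ≤ L) :
    loopIntegral (β := β) W bc a k (fun f => ENNReal.ofReal b * crossingMajorant Z r D f)
      ≤ ENNReal.ofReal (boxVolume d a * kernelBound d β bc a k) := by
  have hV := (boxVolume_pos (d := d) ha).le
  have hkernel := kernelBound_nonneg (d := d) (β := β) (bc := bc) ha k
  have hrate := one_le_displacementRate (d := d) (β := β)
  rw [loopIntegral_const_mul _ _ _ _ ENNReal.ofReal_ne_top]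
  calc _ ≤ ENNReal.ofReal b * ENNReal.ofReal
        ((d * D / r + Real.exp (-D) * displacementRate d β ^ L)
          * (boxVolume d a * kernelBound d β bc a k)) := by
        gcongr
        refine (loopIntegral_crossingMajorant_le hd hβ hW bc ha hr hD hDr hZ hk).trans ?_
        gcongr
    _ ≤ _ := by
        rw [← ENNReal.ofReal_mul hb, ← mul_assoc]
        exact ENNReal.ofReal_le_ofReal (mul_le_of_le_one_left (mul_nonneg hV hkernel) hsmall)

theorem exists_particlesCrossingLe_le (hd : 1 ≤ d) (hβ : 0 < β) {W : Measure C(ℝ≥0, Space d)}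
    (hW : IsWienerMeasure W) {v : Space d → ℝ} (hv : AssumptionV v) :
    ∃ C₁ : ℝ, ∀ L : ℕ, ∃ C₂ : ℝ, ∀ (bc : BC) (a r D : ℝ), 1 ≤ a → 0 < r → 0 ≤ D → D ≤ r →
      IsPartitioned d a r →
      Real.exp (L * L) * (d * D / r + Real.exp (-D) * displacementRate d β ^ L) ≤ 1 → ∀ c : ℝ,
      transformedLaw W β v bc a {ω | c < (particlesCrossingLe bc a r L ω : ℝ)}
        ≤ ENNReal.ofReal (Real.exp (-(L * c) + (C₁ * boxVolume d a + C₂))) := by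
  classical
  obtain ⟨C₁, hmain⟩ := exists_transformedLaw_le hd hβ hW hv
  refine ⟨C₁, fun L => ?_⟩
  obtain ⟨C₂, hmain⟩ := hmain L L.cast_nonneg
  refine ⟨C₂, fun bc a r D ha hr hD hDr ⟨Z, hZ⟩ hsmall c => ?_⟩
  have ha0 : 0 < a := by linarith
  have hsub : ∀ n ∈ Z, cube (latticePoint (2 * r) n) r ⊆ cube (0 : Space d) a := fun n hn =>
    hZ ▸ Set.subset_biUnion_of_mem (u := fun n => cube (latticePoint (2 * r) n) r) hn
  refine hmain bc a ha (fun f => ¬ NonCrossing bc a r f ∧ f.1 ≤ L)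
    (fun f => if f.1 ≤ L then ENNReal.ofReal (Real.exp (L * L)) * crossingMajorant Z r D f else 0)
    (((measurable_crossingMajorant Z r D).const_mul _).ite
      (measurableSet_le (measurable_of_comp_sigmaMk fun _ => measurable_const) measurable_const)
      measurable_const)
    (fun f ⟨hf, hfL⟩ => ?_) (fun k hk => ?_) c
  · rw [if_pos hfL]
    have hexp : Real.exp (L * f.1 - selfEnergy (bcPotential bc a v) f) ≤ Real.exp (L * L) := by
      apply Real.exp_le_exp.2
      have hlength : (L : ℝ) * f.1 ≤ L * L := by gcongr
      linarith [selfEnergy_nonneg (bcPotential_nonneg hv bc a) f]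
    calc _ ≤ ENNReal.ofReal (Real.exp (L * L)) * 1 := by
          rw [mul_one]
          exact ENNReal.ofReal_le_ofReal hexp
      _ ≤ _ := by
          refine le_add_left ?_
          gcongr
          exact one_le_crossingMajorant D hr.le hsub hf
  · by_cases hkL : k ≤ L
    · simpa only [loopIntegral, if_pos hkL] using loopIntegral_crossingMajorant_le_of_le hd hβ hW bc
        ha0 hr hD hDr hZ (Real.exp_pos (L * L)).le hsmall hk hkL
    · simp only [loopIntegral, if_neg hkL, lintegral_zero, zero_le]

end Crossing

open Filter Topology

/-! ### Superexponential decay -/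

theorem one_div_mul_log_le {q : ℝ≥0∞} {V y : ℝ} (hV : 0 < V)
    (hq : q ≤ ENNReal.ofReal (Real.exp y)) :
    ((1 / V : ℝ) : EReal) * ENNReal.log q ≤ ((y / V : ℝ) : EReal) := by
  have hlog : ENNReal.log q ≤ (y : EReal) := by
    refine (ENNReal.log_monotone hq).trans_eq ?_
    rw [ENNReal.log_ofReal_of_pos (Real.exp_pos y), Real.log_exp]
  have hinv : (0 : EReal) ≤ ((1 / V : ℝ) : EReal) := EReal.coe_nonneg.2 (by positivity)
  refine (mul_le_mul_of_nonneg_left hlog hinv).trans_eq ?_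
  rw [← EReal.coe_mul, one_div_mul_eq_div]

theorem limsup_limsup_log_eq_bot {ι κ : Type*} {l : Filter ι} [l.NeBot] {m : Filter κ}
    {Q : ι → κ → ℝ≥0∞} {V : κ → ℝ} (hV : Tendsto V m atTop) {θ : ι → ℝ} (hθ : Tendsto θ l atTop)
    {ε C₁ : ℝ} (hε : 0 < ε) {C₂ : ι → ℝ}
    (hQ : ∀ᶠ i in l, ∀ᶠ j in m, Q i j ≤
      ENNReal.ofReal (Real.exp (-(θ i * (ε * V j)) + (C₁ * V j + C₂ i)))) :
    limsup (fun i => limsup (fun j => ((1 / V j : ℝ) : EReal) * ENNReal.log (Q i j)) m) l = ⊥ := by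
  have hbound : ∀ᶠ i in l, limsup (fun j => ((1 / V j : ℝ) : EReal) * ENNReal.log (Q i j)) m
      ≤ ((-(θ i * ε) + (C₁ + 1) : ℝ) : EReal) := by
    filter_upwards [hQ] with i hQi
    refine limsup_le_of_le (h := ?_)
    filter_upwards [hQi, hV.eventually_gt_atTop 0, hV.eventually_ge_atTop (C₂ i)] with j hQij hj hC₂
    refine (one_div_mul_log_le hj hQij).trans (EReal.coe_le_coe_iff.2 ?_)
    rw [div_le_iff₀ hj]
    linear_combination hC₂
  have hlim : Tendsto (fun i => ((-(θ i * ε) + (C₁ + 1) : ℝ) : EReal)) l (𝓝 ⊥) :=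
    EReal.tendsto_coe_nhds_bot_iff.2 (tendsto_atBot_add_const_right _ _
      (tendsto_neg_atTop_atBot.comp (hθ.atTop_mul_const hε)))
  exact le_bot_iff.1 ((limsup_le_limsup hbound).trans_eq hlim.limsup_eq)

theorem exists_tendsto_atTop_eventually_diagonal {P : ℕ → ℕ → Prop}
    (hP : ∀ L, ∀ᶠ R in atTop, P L R) :
    ∃ L : ℕ → ℕ, Tendsto L atTop atTop ∧ ∀ᶠ R in atTop, P (L R) R := by
  choose M hM using fun L => eventually_atTop.1 (hP L)
  refine ⟨fun R => Nat.findGreatest (fun L => M L ≤ R) R, tendsto_atTop.2 fun b => ?_, ?_⟩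
  · filter_upwards [eventually_ge_atTop (max b (M b))] with R hR
    exact Nat.le_findGreatest ((le_max_left _ _).trans hR) ((le_max_right _ _).trans hR)
  · filter_upwards [eventually_ge_atTop (M 0)] with R hR
    exact hM _ R (Nat.findGreatest_spec (P := fun L => M L ≤ R) (Nat.zero_le R) hR)

theorem eventually_mul_sqrt_div_add_exp_neg_sqrt_le_one (b c A : ℝ) : ∀ᶠ R : ℕ in atTop,
    b * (c * √(R : ℝ) / (R / 2) + Real.exp (-√(R : ℝ)) * A) ≤ 1 := by
  have hsqrt : Tendsto (fun R : ℕ => √(R : ℝ)) atTop atTop :=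
    Real.tendsto_sqrt_atTop.comp tendsto_natCast_atTop_atTop
  have hfrac : Tendsto (fun R : ℕ => c * √(R : ℝ) / (R / 2)) atTop (𝓝 0) := by
    have hinv := (tendsto_inv_atTop_zero.comp hsqrt).const_mul (c * 2)
    rw [mul_zero] at hinv
    refine hinv.congr fun R => ?_
    rw [Function.comp_apply, ← Real.sqrt_div_self]
    ring
  have hexp := (Real.tendsto_exp_neg_atTop_nhds_zero.comp hsqrt).mul_const A
  have hlim := (hfrac.add hexp).const_mul b
  simp only [zero_mul, add_zero, mul_zero] at hlim
  exact (hlim.eventually_lt_const one_pos).mono fun R hR => hR.le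

theorem tendsto_boxVolume_atTop {d : ℕ} (hd : 1 ≤ d) : Tendsto (boxVolume d) atTop atTop :=
  (tendsto_pow_atTop (by omega)).comp (tendsto_id.const_mul_atTop two_pos)

theorem tendsto_atTop_of_boxVolume_div {d : ℕ} {a : ℕ → ℝ} (ha : ∀ N, 0 < a N) {ρ : ℝ}
    (hρ : 0 < ρ) (hvol : Tendsto (fun N : ℕ => boxVolume d (a N) / N) atTop (𝓝 (1 / ρ))) :
    Tendsto a atTop atTop := by
  have hV : Tendsto (fun N => boxVolume d (a N)) atTop atTop := by
    refine (hvol.pos_mul_atTop (by positivity) tendsto_natCast_atTop_atTop).congr' ?_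
    filter_upwards [eventually_gt_atTop 0] with N hN
    exact div_mul_cancel₀ _ (by positivity)
  refine tendsto_atTop.2 fun b => ?_
  filter_upwards [hV.eventually_gt_atTop (boxVolume d b)] with N hN
  contrapose! hN
  exact pow_le_pow_left₀ (by linarith [ha N]) (by linarith) d

section Limsup

variable {d : ℕ} {β : ℝ≥0}

theorem exists_limsup_particlesNonCrossingGt_eq_bot (hd : 1 ≤ d) (hβ : 0 < β)
    {W : Measure C(ℝ≥0, Space d)} (hW : IsWienerMeasure W) {v : Space d → ℝ}
    (hv : AssumptionV v) :
    ∃ L : ℕ → ℕ, Tendsto L atTop atTop ∧ ∀ a : ℕ → ℝ, Tendsto a atTop atTop →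
      ∀ r : ℕ → ℕ → ℝ, (∀ R : ℕ, 1 ≤ R → Tendsto (r R) atTop (𝓝 (R : ℝ))) →
      ∀ (bc : BC) (ε : ℝ), 0 < ε →
        limsup (fun R : ℕ => limsup (fun N : ℕ => ((1 / boxVolume d (a N) : ℝ) : EReal) *
          ENNReal.log (transformedLaw W β v bc (a N) {ω | ε * boxVolume d (a N) <
            (particlesNonCrossingGt bc (a N) (r R N) (L R) ω : ℝ)})) atTop) atTop = ⊥ := by
  obtain ⟨C₁, hbound⟩ := exists_particlesNonCrossingGt_le hd hβ hW hv
  choose L C₂ hRL hbound using hbound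
  refine ⟨L, tendsto_atTop_mono hRL tendsto_id, fun a ha r hr bc ε hε => ?_⟩
  refine limsup_limsup_log_eq_bot ((tendsto_boxVolume_atTop hd).comp ha)
    tendsto_natCast_atTop_atTop hε (C₁ := C₁) (C₂ := C₂) ?_
  filter_upwards [eventually_ge_atTop 1] with R hR
  have hR0 : (0 : ℝ) < R := by exact_mod_cast hR
  filter_upwards [ha.eventually_ge_atTop 1, (hr R hR).eventually_const_lt hR0,
    (hr R hR).eventually_lt_const (lt_add_one _)] with N haN hrN hrN'
  exact hbound R bc (a N) (r R N) haN hrN.le hrN'.le _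

theorem exists_limsup_particlesCrossingLe_eq_bot (hd : 1 ≤ d) (hβ : 0 < β)
    {W : Measure C(ℝ≥0, Space d)} (hW : IsWienerMeasure W) {v : Space d → ℝ}
    (hv : AssumptionV v) :
    ∃ L : ℕ → ℕ, Tendsto L atTop atTop ∧ ∀ a : ℕ → ℝ, Tendsto a atTop atTop →
      ∀ r : ℕ → ℕ → ℝ, (∀ R : ℕ, 1 ≤ R → Tendsto (r R) atTop (𝓝 (R : ℝ)) ∧
        ∀ᶠ N in atTop, IsPartitioned d (a N) (r R N)) →
      ∀ (bc : BC) (ε : ℝ), 0 < ε →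
        limsup (fun R : ℕ => limsup (fun N : ℕ => ((1 / boxVolume d (a N) : ℝ) : EReal) *
          ENNReal.log (transformedLaw W β v bc (a N) {ω | ε * boxVolume d (a N) <
            (particlesCrossingLe bc (a N) (r R N) (L R) ω : ℝ)})) atTop) atTop = ⊥ := by
  obtain ⟨C₁, hbound⟩ := exists_particlesCrossingLe_le hd hβ hW hv
  choose C₂ hbound using hbound
  obtain ⟨L, hL, hsmall⟩ := exists_tendsto_atTop_eventually_diagonal fun L =>
    eventually_mul_sqrt_div_add_exp_neg_sqrt_le_one (Real.exp (L * L)) d (displacementRate d β ^ L)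
  refine ⟨L, hL, fun a ha r hr bc ε hε => ?_⟩
  refine limsup_limsup_log_eq_bot ((tendsto_boxVolume_atTop hd).comp ha)
    (tendsto_natCast_atTop_atTop.comp hL) hε (C₁ := C₁) (C₂ := fun R => C₂ (L R)) ?_
  filter_upwards [hsmall, eventually_ge_atTop 4] with R hsmallR hR
  have hR4 : (4 : ℝ) ≤ R := by exact_mod_cast hR
  have hsqrt : √(R : ℝ) ≤ R / 2 := Real.sqrt_le_iff.2 ⟨by positivity, by nlinarith⟩
  obtain ⟨hlim, hpartition⟩ := hr R (by omega)
  filter_upwards [ha.eventually_ge_atTop 1, hpartition,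
    hlim.eventually_const_lt (half_lt_self (by linarith))] with N haN hpartitionN hrN
  refine hbound (L R) bc (a N) (r R N) √(R : ℝ) haN (by linarith) (Real.sqrt_nonneg _)
    (hsqrt.trans hrN.le) hpartitionN (le_trans ?_ hsmallR) _
  gcongr

end Limsup

end BoseLoops

open BoseLoops Filter Topology

theorem lemma3p2_general {d : ℕ} (hd : 1 ≤ d) {W : MeasureTheory.Measure C(ℝ≥0, Space d)}
    (hW : IsWienerMeasure W) {β : ℝ≥0} (hβ : 0 < β) {v : Space d → ℝ} (hv : AssumptionV v) :
    ∃ Lle Lgt : ℕ → ℕ, Tendsto Lle atTop atTop ∧ Tendsto Lgt atTop atTop ∧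
      ∀ a : ℕ → ℝ, Tendsto a atTop atTop →
      ∀ r : ℕ → ℕ → ℝ, (∀ R : ℕ, 1 ≤ R → Tendsto (r R) atTop (𝓝 (R : ℝ)) ∧
        ∀ᶠ N in atTop, IsPartitioned d (a N) (r R N)) →
      ∀ (bc : BC) (ε : ℝ), 0 < ε →
        limsup (fun R : ℕ => limsup (fun N : ℕ => ((1 / boxVolume d (a N) : ℝ) : EReal) *
          ENNReal.log (transformedLaw W β v bc (a N) {ω | ε * boxVolume d (a N) <
            (particlesCrossingLe bc (a N) (r R N) (Lle R) ω : ℝ)})) atTop) atTop = ⊥ ∧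
        limsup (fun R : ℕ => limsup (fun N : ℕ => ((1 / boxVolume d (a N) : ℝ) : EReal) *
          ENNReal.log (transformedLaw W β v bc (a N) {ω | ε * boxVolume d (a N) <
            (particlesNonCrossingGt bc (a N) (r R N) (Lgt R) ω : ℝ)})) atTop) atTop = ⊥ := by
  obtain ⟨Lle, hLle, hcrossing⟩ := exists_limsup_particlesCrossingLe_eq_bot hd hβ hW hv
  obtain ⟨Lgt, hLgt, hnonCrossing⟩ := exists_limsup_particlesNonCrossingGt_eq_bot hd hβ hW hv
  exact ⟨Lle, Lgt, hLle, hLgt, fun a ha r hr bc ε hε =>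
    ⟨hcrossing a ha r hr bc ε hε, hnonCrossing a ha r (fun R hR => (hr R hR).1) bc ε hε⟩⟩

theorem lemma3p2 (d : ℕ) (hd : 1 ≤ d)
    -- Wiener measure, the inverse temperature, the pair potential, and the particle density
    (W : MeasureTheory.Measure C(NNReal, BoseLoops.Space d)) (hW : BoseLoops.IsWienerMeasure W)
    (β : NNReal) (hβ : 0 < β)
    (v : BoseLoops.Space d → ℝ) (hv : BoseLoops.AssumptionV v)
    (ρ : ℝ) (hρ : 0 < ρ)
    -- the centred boxes `Λ_N = [-a N, a N]^d`
    (a : ℕ → ℝ) (ha : ∀ N, 0 < a N)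
    (hvol : Filter.Tendsto (fun N : ℕ => BoseLoops.boxVolume d (a N) / N) Filter.atTop
      (nhds (1 / ρ))) :
    ∃ Lle Lgt : ℕ → ℕ,
      Filter.Tendsto Lle Filter.atTop Filter.atTop ∧
      Filter.Tendsto Lgt Filter.atTop Filter.atTop ∧
      -- the half side lengths `r R N → R` of the subboxes into which `Λ_N` is partitioned
      ∀ r : ℕ → ℕ → ℝ,
        (∀ R : ℕ, 1 ≤ R → Filter.Tendsto (r R) Filter.atTop (nhds (R : ℝ)) ∧
          ∀ᶠ N in Filter.atTop, BoseLoops.IsPartitioned d (a N) (r R N)) →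
      ∀ (bc : BoseLoops.BC) (ε : ℝ), 0 < ε → ε < 1 →
        Filter.limsup (fun R : ℕ => Filter.limsup (fun N : ℕ =>
          ((1 / BoseLoops.boxVolume d (a N) : ℝ) : EReal) *
            ENNReal.log (BoseLoops.transformedLaw W β v bc (a N)
              {ω | ε * BoseLoops.boxVolume d (a N) <
                (BoseLoops.particlesCrossingLe bc (a N) (r R N) (Lle R) ω : ℝ)}))
          Filter.atTop) Filter.atTop = ⊥ ∧
        Filter.limsup (fun R : ℕ => Filter.limsup (fun N : ℕ =>
          ((1 / BoseLoops.boxVolume d (a N) : ℝ) : EReal) *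
            ENNReal.log (BoseLoops.transformedLaw W β v bc (a N)
              {ω | ε * BoseLoops.boxVolume d (a N) <
                (BoseLoops.particlesNonCrossingGt bc (a N) (r R N) (Lgt R) ω : ℝ)}))
          Filter.atTop) Filter.atTop = ⊥ := by
  obtain ⟨Lle, Lgt, hLle, hLgt, hlimsup⟩ := lemma3p2_general hd hW hβ hv
  exact ⟨Lle, Lgt, hLle, hLgt, fun r hr bc ε hε _ =>
    hlimsup a (tendsto_atTop_of_boxVolume_div ha hρ hvol) r hr bc ε hε⟩
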